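/- **Setting.** Let $q$ be a random element of a measurable space $\mathbb{Q}$ with probability law $\mathrm{Prob}$, let $\Theta\subset\mathbb{R}^n$ be convex and compact, let $c\in\mathbb{R}^n$, and let $f:\mathbb{R}^n\times\mathbb{Q}\to\mathbb{R}$ be convex in its first argument and measurable in its second. Put $V(\theta)=\mathrm{Prob}\{q: f(\theta,q)>0\}$. For i.i.d. scenarios $\omega=(q^{(1)},\dots,q^{(m)})$ consider the scenario problem $$\min_{\theta\in\Theta} c^\top\theta\quad\text{s.t. } f(\theta,q^{(i)})\le 0,\ i=1,\dots,m. \qquad (\ast)$$ The $j$-th constraint is a *support constraint* if deleting it strictly lowers the optimal value; $(\ast)$ is *fully supported with probability one* if, almost surely in $\omega$, it has exactly $n$ support constraints. Let $\varepsilon\in[0,1]$, $N\ge n$, and $$1-\beta_\varepsilon(N)=\sum_{i=n}^{N}\binom{N}{i}\varepsilon^i(1-\varepsilon)^{N-i}.$$ Assume that, with probability one, $(\ast)$ is feasible and has a unique optimal solution $\theta^*(\omega)$, for $m=N$ scenarios and, in case $N=n$, also for $m=n+1$ scenarios. **Algorithm (repetitive scenario design with an exact $\varepsilon$-violation oracle).**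 Start with $k=1$. At iteration $k$ draw a fresh independent multisample $\omega^{(k)}$ of $N$ i.i.d. scenarios and let $\theta^*_k$ be an optimal solution of the corresponding problem $(\ast)$. If $V(\theta_k^*)\le\varepsilon$, exit and return $\theta^*=\theta^*_k$; otherwise increase $k$ by one and repeat. Let $K\in\{1,2,\dots\}\cup\{\infty\}$ be the value of $k$ at exit ($K=\infty$ if the algorithm never exits). **Theorem.** $K$ is a random variable (up to null sets), and: 1. Any returned solution $\theta^*$ satisfies $V(\theta^*)\le\varepsilon$. 2. $\mathbb{E}[K]\le (1-\beta_\varepsilon(N))^{-1}$, where $0^{-1}=\infty$. 3. For every integer $k\ge 0$, $K\le k$ with probability at least $1-\beta_\varepsilon(N)^k$, where $\beta_\varepsilon(N)^0=1$. Moreover, equality holds in 2 and in 3 (for every $k$) if $(\ast)$ is fully supported with probability one for $m=N$ scenarios and, in case $N=n$, also for $m=n+1$ scenarios. -/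

import Mathlib

open MeasureTheory
open scoped ENNReal

noncomputable section

/-- The data of a scenario design problem with decision variable in `ℝⁿ` and uncertainty in `Q`:
the objective direction `c`, the domain `Θ`, and the spec function `f(θ, q)`. -/
structure ScenarioProblem (n : ℕ) (Q : Type*) where
  c : EuclideanSpace ℝ (Fin n)
  Θ : Set (EuclideanSpace ℝ (Fin n))
  f : EuclideanSpace ℝ (Fin n) → Q → ℝ

namespace ScenarioProblem

variable {n : ℕ} {Q : Type*}

/-- The linear cost `cᵀ θ`. -/
def cost (S : ScenarioProblem n Q) (θ : EuclideanSpace ℝ (Fin n)) : ℝ :=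
  inner ℝ S.c θ

/-- The points `θ ∈ Θ` that satisfy the scenario constraints `f(θ, q⁽ⁱ⁾) ≤ 0` for `i ∈ I`. -/
def feasible (S : ScenarioProblem n Q) {m : ℕ} (ω : Fin m → Q) (I : Finset (Fin m)) :
    Set (EuclideanSpace ℝ (Fin n)) :=
  {θ | θ ∈ S.Θ ∧ ∀ i ∈ I, S.f θ (ω i) ≤ 0}

/-- `θ` is an optimal solution of the scenario problem with scenarios `ω = (q⁽¹⁾, …, q⁽ᵐ⁾)`:
minimize `cᵀ θ` over `Θ` subject to `f(θ, q⁽ⁱ⁾) ≤ 0` for all `i`. -/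
def IsOptimal (S : ScenarioProblem n Q) {m : ℕ} (ω : Fin m → Q)
    (θ : EuclideanSpace ℝ (Fin n)) : Prop :=
  θ ∈ S.feasible ω Finset.univ ∧ ∀ θ' ∈ S.feasible ω Finset.univ, S.cost θ ≤ S.cost θ'

/-- The optimal value of the problem in which only the constraints `i ∈ I` are kept. (It is used
for feasible problems on a compact domain, for which the infimum is attained.) -/
def optValue (S : ScenarioProblem n Q) {m : ℕ} (ω : Fin m → Q) (I : Finset (Fin m)) : ℝ :=
  sInf (S.cost '' S.feasible ω I)

/-- The `j`-th constraint is a support constraint: its removal strictly lowers the optimum. -/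
def IsSupport (S : ScenarioProblem n Q) {m : ℕ} (ω : Fin m → Q) (j : Fin m) : Prop :=
  S.optValue ω (Finset.univ.erase j) < S.optValue ω Finset.univ

/-- The instance `ω` is fully supported: it has exactly `n` support constraints. -/
def FullySupported (S : ScenarioProblem n Q) {m : ℕ} (ω : Fin m → Q) : Prop :=
  {j : Fin m | S.IsSupport ω j}.ncard = n

variable [MeasurableSpace Q]

/-- With probability one over `m` i.i.d. scenarios, the scenario problem is feasible and attains a
unique optimal solution. -/
def UniquelySolvable (S : ScenarioProblem n Q) (P : Measure Q) [IsProbabilityMeasure P]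
    (m : ℕ) : Prop :=
  ∀ᵐ ω ∂(Measure.pi fun _ : Fin m => P), ∃! θ, S.IsOptimal ω θ

/-- With probability one over `m` i.i.d. scenarios, the scenario problem is fully supported. -/
def FullySupportedAE (S : ScenarioProblem n Q) (P : Measure Q) [IsProbabilityMeasure P]
    (m : ℕ) : Prop :=
  ∀ᵐ ω ∂(Measure.pi fun _ : Fin m => P), S.FullySupported ω

/-- The probability of violation `V(θ) = Prob {q | f(θ, q) > 0}`. -/
def violation (S : ScenarioProblem n Q) (P : Measure Q)
    (θ : EuclideanSpace ℝ (Fin n)) : ℝ :=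
  P.real {q | 0 < S.f θ q}

/-- A solver for the problem with `N` scenarios returns an optimal solution whenever there is
one. -/
def IsSolver (S : ScenarioProblem n Q) {N : ℕ}
    (sol : (Fin N → Q) → EuclideanSpace ℝ (Fin n)) : Prop :=
  ∀ ω, (∃ θ, S.IsOptimal ω θ) → S.IsOptimal ω (sol ω)

end ScenarioProblem

/-- `1 - β_ε(N) = ∑_{i=n}^{N} (N choose i) εⁱ (1-ε)^{N-i}`, solved for `β_ε(N)`. -/
def scenarioBeta (n N : ℕ) (ε : ℝ) : ℝ :=
  1 - ∑ i ∈ Finset.Icc n N, (N.choose i : ℝ) * ε ^ i * (1 - ε) ^ (N - i)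

/-- States of the repetitive scenario design algorithm: about to perform iteration `k`, or exited
with iteration counter `k` and returned solution `θ`. -/
inductive RSDState (n : ℕ) where
  | running (k : ℕ) : RSDState n
  | exited (k : ℕ) (θ : EuclideanSpace ℝ (Fin n)) : RSDState n

namespace ScenarioProblem

variable {n : ℕ} {Q : Type*} [MeasurableSpace Q]

open Classical in
/-- One pass of the algorithm, with `w k` the multisample drawn at iteration `k`: solve the scenario
problem, query the exact `ε`-violation oracle, then exit or increase the counter. -/
def rsdStep (S : ScenarioProblem n Q) (P : Measure Q) (ε : ℝ) {N : ℕ}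
    (sol : (Fin N → Q) → EuclideanSpace ℝ (Fin n)) (w : ℕ → Fin N → Q) :
    RSDState n → RSDState n
  | .running k =>
      if S.violation P (sol (w k)) ≤ ε then .exited k (sol (w k)) else .running (k + 1)
  | .exited k θ => .exited k θ

/-- On the run `w`, the algorithm (started with counter `1`) exits at iteration `k` and
returns `θ`. -/
def RSDExits (S : ScenarioProblem n Q) (P : Measure Q) (ε : ℝ) {N : ℕ}
    (sol : (Fin N → Q) → EuclideanSpace ℝ (Fin n)) (w : ℕ → Fin N → Q)
    (k : ℕ) (θ : EuclideanSpace ℝ (Fin n)) : Prop :=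
  ∃ t : ℕ, (S.rsdStep P ε sol w)^[t] (.running 1) = .exited k θ

/-- The running time `K`: the value of the iteration counter when the algorithm exits, and `⊤` if it
never exits. -/
def rsdTime (S : ScenarioProblem n Q) (P : Measure Q) (ε : ℝ) {N : ℕ}
    (sol : (Fin N → Q) → EuclideanSpace ℝ (Fin n)) (w : ℕ → Fin N → Q) : ℕ∞ :=
  ⨅ (k : ℕ) (_ : ∃ θ, S.RSDExits P ε sol w k θ), (k : ℕ∞)

end ScenarioProblem

/-- The law of the multisamples `w 1, w 2, …` drawn by the algorithm: all scenarios are independent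
with distribution `P`. (The coordinate `w 0` is not used.) -/
def rsdLaw {Q : Type*} [MeasurableSpace Q] (P : Measure Q) [IsProbabilityMeasure P] (N : ℕ) :
    Measure (ℕ → Fin N → Q) :=
  Measure.infinitePi fun _ : ℕ => Measure.pi fun _ : Fin N => P

end

/-! ### Binomial tails and the Beta law with parameters n and 1. -/

noncomputable section

/-! The crux is that V(θ*) ≤ ε has probability at least `binomTail n N ε`. The multisamples are
independent, so K is geometric with the actual success probability, and both bounds on K follow.

Call an n-subset of a sample a compression if the data it determines accept all remaining scenarios.
Suppose almost every m-sample has exactly one compression. Splitting the sample into independent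
blocks gives C(m,n) ∫ (1-a)^(m-n) dF(a) = 1, where F is the law of the rejection probability of n
scenarios. Over all m ≥ n these moments force F to be the Beta law of `maxUniformLaw`
(`map_rejection_eq_maxUniformLaw`), and cutting the integral off at a ≤ ε produces the binomial tail
(`measure_exists_isCompression_le`).

In general fewer than n constraints may determine the solution, so uniqueness is forced by
perturbation. Adding δ‖θ‖² makes the cost strictly convex; every scenario receives an independent
uniform label u, and its constraint is relaxed to f ≤ ρu. Almost surely there is then one minimal
set of essential constraints, of size at most n by Helly, and filling it up with the lowest labels
gives the unique compression (`ae_nondegenerate`, `Nondegenerate.isCompression_iff`). Letting ρ → 0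
and then δ → 0, semicontinuity of V carries the bound over to the least-norm optimum, which is
almost surely the unique one.

In the fully supported case the support constraints already form the unique compression, without
labels, but the hypothesis supplies a moment identity at only one sample size M > n. The inequality
for m = n says that F is stochastically below the Beta law, and one matching moment then forces
equality (`eq_maxUniformLaw_of_le`). -/

/-- The upper tail `∑_{i=n}^{N} (N choose i) xⁱ (1-x)^{N-i}` of the binomial distribution. -/
def binomTail (n N : ℕ) (x : ℝ) : ℝ :=
  ∑ i ∈ Finset.Icc n N, (N.choose i : ℝ) * x ^ i * (1 - x) ^ (N - i)

theorem binomTail_succ_add {n N : ℕ} (h : n ≤ N) (x : ℝ) :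
    binomTail n N x = (N.choose n : ℝ) * x ^ n * (1 - x) ^ (N - n) + binomTail (n + 1) N x := by
  unfold binomTail
  rw [← Finset.insert_Icc_add_one_left_eq_Icc h, Finset.sum_insert (by simp)]

/-- The differentiated sum telescopes, because (k+1) C(N,k+1) = (N-k) C(N,k): only the contribution
of the lowest index survives. Hence the downward induction from n = N. -/
theorem hasDerivAt_binomTail {n N : ℕ} (hn : n ≠ 0) (h : n ≤ N) (x : ℝ) :
    HasDerivAt (binomTail n N) (N.choose n * (n * x ^ (n - 1)) * (1 - x) ^ (N - n)) x := by
  revert hn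
  induction h using Nat.decreasingInduction with
  | self =>
    intro hn
    have : binomTail N N = fun x => x ^ N := by funext y; simp [binomTail]
    rw [this]
    simpa using hasDerivAt_pow N x
  | of_succ k hk ih =>
    intro hn
    have hk' : k + 1 ≤ N := hk
    have hf : binomTail k N = fun x =>
        (N.choose k : ℝ) * x ^ k * (1 - x) ^ (N - k) + binomTail (k + 1) N x :=
      funext fun y => binomTail_succ_add (by omega) y
    have h1 : HasDerivAt (fun x : ℝ => (1 - x) ^ (N - k))
        ((N - k : ℕ) * (1 - x) ^ (N - k - 1) * (-1)) x := by
      have := ((hasDerivAt_id x).const_sub 1).pow (N - k)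
      simpa [Pi.pow_def] using this
    have h2 := (((hasDerivAt_pow k x).const_mul (N.choose k : ℝ)).mul h1).add (ih (by omega))
    rw [hf]
    refine h2.congr_deriv ?_
    have hc : (N.choose (k + 1) : ℝ) * (k + 1) = N.choose k * (N - k : ℕ) := by
      exact_mod_cast Nat.choose_succ_right_eq N k
    have e1 : N - (k + 1) = N - k - 1 := by omega
    rw [e1]
    simp only [Nat.add_sub_cancel, Nat.cast_add, Nat.cast_one]
    linear_combination (x ^ k * (1 - x) ^ (N - k - 1)) * hc

theorem binomTail_zero_right {n N : ℕ} (hn : n ≠ 0) : binomTail n N 0 = 0 := by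
  refine Finset.sum_eq_zero fun i hi => ?_
  have : i ≠ 0 := by have := (Finset.mem_Icc.1 hi).1; omega
  simp [this]

theorem binomTail_zero_left (N : ℕ) (x : ℝ) : binomTail 0 N x = 1 := by
  have h := add_pow x (1 - x) N
  rw [add_sub_cancel, one_pow] at h
  rw [h, binomTail]
  have : Finset.Icc 0 N = Finset.range (N + 1) := by ext; simp
  rw [this]
  exact Finset.sum_congr rfl fun i _ => by ring

theorem binomTail_one {n N : ℕ} (h : n ≤ N) : binomTail n N 1 = 1 := by
  unfold binomTail
  rw [Finset.sum_eq_single N]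
  · simp
  · intro b hb hbN
    have := (Finset.mem_Icc.1 hb).2
    have : N - b ≠ 0 := by omega
    simp [this]
  · intro h'; simp [h] at h'

theorem binomTail_nonneg (n N : ℕ) {x : ℝ} (hx : x ∈ Set.Icc (0 : ℝ) 1) : 0 ≤ binomTail n N x :=
  Finset.sum_nonneg fun i _ => by
    have := hx.1
    have : 0 ≤ 1 - x := sub_nonneg.2 hx.2
    positivity

theorem binomTail_le_one (n N : ℕ) {x : ℝ} (hx : x ∈ Set.Icc (0 : ℝ) 1) : binomTail n N x ≤ 1 := by
  rw [← binomTail_zero_left N x]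
  refine Finset.sum_le_sum_of_subset_of_nonneg (Finset.Icc_subset_Icc_left (Nat.zero_le _)) ?_
  intro i _ _
  have := hx.1
  have : 0 ≤ 1 - x := sub_nonneg.2 hx.2
  positivity

theorem binomTail_self (n : ℕ) (x : ℝ) : binomTail n n x = x ^ n := by
  simp [binomTail]

/-- The law of the maximum of `n` independent uniform random variables, i.e. the Beta law with
parameters `n` and `1` (a point mass at `0` when `n = 0`). -/
def maxUniformLaw (n : ℕ) : Measure ℝ :=
  if n = 0 then Measure.dirac 0
  else (volume.restrict (Set.Ioc (0 : ℝ) 1)).withDensity fun a => ENNReal.ofReal (n * a ^ (n - 1))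

/-- The integrand times the Beta density is the derivative of `binomTail n N`, which vanishes at 0.
For n = 0 the law is a point mass at 0 and the tail is identically 1. -/
theorem choose_mul_setLIntegral_maxUniformLaw {n N : ℕ} (h : n ≤ N) {x : ℝ}
    (hx : x ∈ Set.Icc (0 : ℝ) 1) :
    (N.choose n : ℝ≥0∞) * ∫⁻ a in Set.Iic x, ENNReal.ofReal (1 - a) ^ (N - n) ∂(maxUniformLaw n)
      = ENNReal.ofReal (binomTail n N x) := by
  by_cases hn : n = 0
  · subst hn
    simp only [maxUniformLaw, if_true, binomTail_zero_left]
    rw [restrict_dirac' measurableSet_Iic]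
    simp [hx.1]
  · rw [maxUniformLaw, if_neg hn, setLIntegral_withDensity_eq_setLIntegral_mul _ (by fun_prop)
      (by fun_prop) measurableSet_Iic, Measure.restrict_restrict measurableSet_Iic]
    have hset : Set.Iic x ∩ Set.Ioc (0 : ℝ) 1 = Set.Ioc 0 x := by
      ext a; simp only [Set.mem_inter_iff, Set.mem_Iic, Set.mem_Ioc]
      have := hx.2
      constructor
      · rintro ⟨h1, h2, h3⟩; exact ⟨h2, h1⟩
      · rintro ⟨h1, h2⟩; exact ⟨h2, h1, h2.trans this⟩
    rw [hset]
    have hcont : Continuous fun a : ℝ => (N.choose n : ℝ) * (n * a ^ (n - 1)) * (1 - a) ^ (N - n) := by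
      fun_prop
    have hI := intervalIntegral.integral_eq_sub_of_hasDerivAt (a := 0) (b := x)
      (fun t _ => hasDerivAt_binomTail hn h t) (hcont.intervalIntegrable _ _)
    rw [binomTail_zero_right hn, sub_zero, intervalIntegral.integral_of_le hx.1] at hI
    rw [← hI, ofReal_integral_eq_lintegral_ofReal
      (hcont.integrableOn_Ioc), ← lintegral_const_mul _ (by fun_prop)]
    · refine setLIntegral_congr_fun measurableSet_Ioc fun a ha => ?_
      have h0 : 0 ≤ a := ha.1.le
      have h1 : 0 ≤ 1 - a := sub_nonneg.2 (ha.2.trans hx.2)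
      simp only [Pi.mul_apply]
      rw [ENNReal.ofReal_mul (by positivity), ENNReal.ofReal_mul (by positivity),
        ENNReal.ofReal_mul (p := (N.choose n : ℝ)) (by positivity),
        ENNReal.ofReal_mul (p := (n : ℝ)) (by positivity),
        ENNReal.ofReal_natCast, ENNReal.ofReal_natCast, ENNReal.ofReal_pow h1, mul_assoc,
        mul_assoc, mul_assoc]
    · filter_upwards [ae_restrict_mem measurableSet_Ioc] with a ha
      have h0 : 0 ≤ a := ha.1.le
      have h1 : 0 ≤ 1 - a := sub_nonneg.2 (ha.2.trans hx.2)
      simp only [Pi.zero_apply]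
      positivity

theorem maxUniformLaw_compl (n : ℕ) : maxUniformLaw n (Set.Icc 0 1)ᶜ = 0 := by
  by_cases hn : n = 0
  · simp [maxUniformLaw, hn]
  · rw [maxUniformLaw, if_neg hn]
    refine withDensity_absolutelyContinuous _ _ ?_
    rw [Measure.restrict_apply measurableSet_Icc.compl]
    have : (Set.Icc (0 : ℝ) 1)ᶜ ∩ Set.Ioc 0 1 = ∅ := by
      ext a; simp only [Set.mem_inter_iff, Set.mem_compl_iff, Set.mem_Icc, Set.mem_Ioc]
      constructor
      · rintro ⟨h1, h2, h3⟩; exact h1 ⟨h2.le, h3⟩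
      · simp
    simp [this]

theorem choose_mul_lintegral_maxUniformLaw {n N : ℕ} (h : n ≤ N) :
    (N.choose n : ℝ≥0∞) * ∫⁻ a, ENNReal.ofReal (1 - a) ^ (N - n) ∂(maxUniformLaw n) = 1 := by
  have h1 := choose_mul_setLIntegral_maxUniformLaw h (x := 1) (by simp)
  rw [binomTail_one h, ENNReal.ofReal_one] at h1
  rw [← h1, Measure.restrict_eq_self_of_ae_mem]
  have : ∀ᵐ a ∂(maxUniformLaw n), a ∈ Set.Icc (0 : ℝ) 1 := maxUniformLaw_compl n
  filter_upwards [this] with a ha using ha.2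

theorem maxUniformLaw_Iic (n : ℕ) {x : ℝ} (hx : x ∈ Set.Icc (0 : ℝ) 1) :
    maxUniformLaw n (Set.Iic x) = ENNReal.ofReal (x ^ n) := by
  have := choose_mul_setLIntegral_maxUniformLaw le_rfl hx (n := n)
  simpa [binomTail_self] using this

instance (n : ℕ) : IsProbabilityMeasure (maxUniformLaw n) :=
  ⟨by simpa using choose_mul_lintegral_maxUniformLaw le_rfl (n := n)⟩

/-- Finite measures on `[0, 1]` are determined by their moments. -/
theorem ext_of_lintegral_one_sub_pow {μ ν : Measure ℝ} [IsFiniteMeasure μ] [IsFiniteMeasure ν]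
    (hμ : μ (Set.Icc 0 1)ᶜ = 0) (hν : ν (Set.Icc 0 1)ᶜ = 0)
    (h : ∀ k : ℕ, ∫⁻ a, ENNReal.ofReal (1 - a) ^ k ∂μ = ∫⁻ a, ENNReal.ofReal (1 - a) ^ k ∂ν) :
    μ = ν := by
  have key : ∀ (ξ : Measure ℝ) [IsFiniteMeasure ξ], ξ (Set.Icc 0 1)ᶜ = 0 →
      (∀ f : ℝ → ℝ, Continuous f → Integrable f ξ) ∧
      (∀ k : ℕ, ∫ a, (1 - a) ^ k ∂ξ = (∫⁻ a, ENNReal.ofReal (1 - a) ^ k ∂ξ).toReal) := by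
    intro ξ _ hξ
    have hae : ∀ᵐ a ∂ξ, a ∈ Set.Icc (0 : ℝ) 1 := hξ
    refine ⟨fun f hf => ?_, fun k => ?_⟩
    · have := hf.continuousOn.integrableOn_compact (μ := ξ) (isCompact_Icc (a := (0 : ℝ)) (b := 1))
      rwa [IntegrableOn, Measure.restrict_eq_self_of_ae_mem hae] at this
    · rw [integral_eq_lintegral_of_nonneg_ae]
      · congr 1
        refine lintegral_congr_ae ?_
        filter_upwards [hae] with a ha
        rw [ENNReal.ofReal_pow (sub_nonneg.2 ha.2)]
      · filter_upwards [hae] with a ha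
        exact pow_nonneg (sub_nonneg.2 ha.2) _
      · fun_prop
  obtain ⟨iμ, mμ⟩ := key μ hμ
  obtain ⟨iν, mν⟩ := key ν hν
  have hpow : ∀ k : ℕ, ∫ a, (1 - a) ^ k ∂μ = ∫ a, (1 - a) ^ k ∂ν := fun k => by
    rw [mμ, mν, h]
  have hpoly' : ∀ p : Polynomial ℝ, ∫ a, p.eval (1 - a) ∂μ = ∫ a, p.eval (1 - a) ∂ν := by
    intro p
    simp only [Polynomial.eval_eq_sum_range]
    rw [integral_finsetSum _ (fun i _ => iμ _ (by fun_prop)),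
      integral_finsetSum _ (fun i _ => iν _ (by fun_prop))]
    exact Finset.sum_congr rfl fun i _ => by rw [integral_const_mul, integral_const_mul, hpow]
  have hpoly : ∀ p : Polynomial ℝ, ∫ a, p.eval a ∂μ = ∫ a, p.eval a ∂ν := by
    intro p
    have := hpoly' (p.comp (1 - Polynomial.X))
    simpa only [Polynomial.eval_comp, Polynomial.eval_sub, Polynomial.eval_one, Polynomial.eval_X,
      sub_sub_cancel] using this
  have hmass : μ.real Set.univ = ν.real Set.univ := by simpa using hpow 0
  refine ext_of_forall_integral_eq_of_IsFiniteMeasure fun f => ?_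
  refine eq_of_forall_dist_le fun e he => ?_
  rw [Real.dist_eq]
  set m := μ.real Set.univ with hm
  have hm0 : 0 ≤ m := measureReal_nonneg
  -- Weierstrass. The tolerance times the common mass m stays below e/2 for each of the two
  -- measures; the +1 covers m = 0.
  obtain ⟨p, hp⟩ := exists_polynomial_near_of_continuousOn 0 1 f f.continuous.continuousOn
    (e / (2 * (m + 1))) (by positivity)
  have bound : ∀ (ξ : Measure ℝ) [IsFiniteMeasure ξ], ξ (Set.Icc 0 1)ᶜ = 0 →
      (∀ f : ℝ → ℝ, Continuous f → Integrable f ξ) → ξ.real Set.univ = m →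
      |∫ a, f a ∂ξ - ∫ a, p.eval a ∂ξ| ≤ e / 2 := by
    intro ξ _ hξ hi hmξ
    rw [← integral_sub (hi _ f.continuous) (hi _ p.continuous), ← Real.norm_eq_abs]
    refine (norm_integral_le_of_norm_le_const (C := e / (2 * (m + 1))) ?_).trans ?_
    · have hae : ∀ᵐ a ∂ξ, a ∈ Set.Icc (0 : ℝ) 1 := hξ
      filter_upwards [hae] with a ha
      rw [Real.norm_eq_abs, abs_sub_comm]
      exact (hp a ha).le
    · rw [hmξ, div_mul_eq_mul_div, div_le_div_iff₀ (by positivity) (by positivity)]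
      nlinarith
  have b1 := bound μ hμ iμ rfl
  have b2 := bound ν hν iν hmass.symm
  rw [← hpoly p] at b2
  rw [abs_le] at b1 b2 ⊢
  constructor <;> linarith [b1.1, b1.2, b2.1, b2.2]

end

/-! ### Sample compression and the law of the rejection probability. -/

noncomputable section

section Samples

variable {X : Type*} {m n k : ℕ}

/-- The subsample of `ω` with indices in `s`, in increasing order. -/
def subTuple (s : Finset (Fin m)) (hs : s.card = n) (ω : Fin m → X) : Fin n → X :=
  fun i => ω (s.orderEmbOfFin hs i)

/-- All elements of `ω` outside `s` are accepted by the subsample with indices in `s`. -/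
def IsCompression (T : (Fin n → X) → X → Prop) (s : Finset (Fin m)) (hs : s.card = n)
    (ω : Fin m → X) : Prop :=
  ∀ j ∉ s, T (subTuple s hs ω) (ω j)

theorem exists_orderEmbOfFin_eq {s : Finset (Fin m)} (hs : s.card = n) {j : Fin m} (hj : j ∈ s) :
    ∃ i, s.orderEmbOfFin hs i = j := by
  have := Finset.range_orderEmbOfFin s hs
  have hj' : j ∈ Set.range (s.orderEmbOfFin hs) := by rw [this]; exact hj
  exact hj'

theorem card_compl_of_card {s : Finset (Fin m)} (hs : s.card = n) : sᶜ.card = m - n := by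
  rw [Finset.card_compl, Fintype.card_fin, hs]

theorem isCompression_iff {T : (Fin n → X) → X → Prop} {s : Finset (Fin m)} (hs : s.card = n)
    (ω : Fin m → X) : IsCompression T s hs ω ↔
      ∀ i, T (subTuple s hs ω) (subTuple sᶜ (card_compl_of_card hs) ω i) := by
  refine ⟨fun h i => h _ ?_, fun h j hj => ?_⟩
  · exact Finset.mem_compl.1 (Finset.orderEmbOfFin_mem _ _ i)
  · obtain ⟨i, hi⟩ := exists_orderEmbOfFin_eq (card_compl_of_card hs) (Finset.mem_compl.2 hj)
    have := h i
    rwa [subTuple, hi] at this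

variable [MeasurableSpace X] (μ : Measure X) [IsProbabilityMeasure μ]

theorem measurable_subTuple (s : Finset (Fin m)) (hs : s.card = n) :
    Measurable (subTuple (X := X) s hs) :=
  measurable_pi_lambda _ fun _ => measurable_pi_apply _

/-- An i.i.d. sample cut along a fixed index set falls into two independent i.i.d. samples. -/
theorem measurePreserving_subTuple_prod (s : Finset (Fin m)) (hs : s.card = n)
    (hc : sᶜ.card = k) :
    MeasurePreserving (fun ω : Fin m → X => (subTuple s hs ω, subTuple sᶜ hc ω))
      (Measure.pi fun _ => μ) ((Measure.pi fun _ => μ).prod (Measure.pi fun _ => μ)) := by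
  have h1 := (measurePreserving_piCongrLeft (fun _ : Fin m => μ) (finSumEquivOfFinset hs hc)).symm
  have h2 := measurePreserving_sumPiEquivProdPi (fun _ : Fin n ⊕ Fin k => μ)
  exact h2.comp h1

theorem measurePreserving_subTuple (s : Finset (Fin m)) (hs : s.card = n) :
    MeasurePreserving (subTuple (X := X) s hs) (Measure.pi fun _ => μ) (Measure.pi fun _ => μ) :=
  measurePreserving_fst.comp (measurePreserving_subTuple_prod μ s hs rfl)

variable {T : (Fin n → X) → X → Prop}

/-- The probability that a new element is rejected by the sample `b`. -/
def rejection (T : (Fin n → X) → X → Prop) (b : Fin n → X) : ℝ := μ.real {x | ¬ T b x}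

theorem measurableSet_accept (hT : MeasurableSet {p : (Fin n → X) × X | T p.1 p.2})
    (b : Fin n → X) : MeasurableSet {x | T b x} :=
  hT.preimage measurable_prodMk_left

theorem measurable_rejection (hT : MeasurableSet {p : (Fin n → X) × X | T p.1 p.2}) :
    Measurable (rejection μ T) :=
  (measurable_measure_prodMk_left (ν := μ) hT.compl).ennreal_toReal

theorem rejection_mem_Icc (b : Fin n → X) : rejection μ T b ∈ Set.Icc (0 : ℝ) 1 :=
  ⟨measureReal_nonneg, measureReal_le_one⟩

theorem measure_accept (hT : MeasurableSet {p : (Fin n → X) × X | T p.1 p.2}) (b : Fin n → X) :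
    μ {x | T b x} = ENNReal.ofReal (1 - rejection μ T b) := by
  have h : rejection μ T b = 1 - μ.real {x | T b x} := probReal_compl_eq_one_sub
    (measurableSet_accept hT b)
  rw [h, sub_sub_cancel, ofReal_measureReal]

theorem measurableSet_isCompression (hT : MeasurableSet {p : (Fin n → X) × X | T p.1 p.2})
    (s : Finset (Fin m)) (hs : s.card = n) : MeasurableSet {ω | IsCompression T s hs ω} := by
  simp only [IsCompression, Set.ofPred_forall]
  refine MeasurableSet.iInter fun j => MeasurableSet.iInter fun _ => ?_
  exact hT.preimage ((measurable_subTuple s hs).prodMk (measurable_pi_apply j))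

/-- Fubini: given the subsample b, the other m - n elements are independent of it and each is
accepted with probability 1 minus the rejection probability of b. -/
theorem measure_isCompression (hT : MeasurableSet {p : (Fin n → X) × X | T p.1 p.2})
    (s : Finset (Fin m)) (hs : s.card = n) {C : Set (Fin n → X)} (hC : MeasurableSet C) :
    (Measure.pi fun _ : Fin m => μ) {ω | IsCompression T s hs ω ∧ subTuple s hs ω ∈ C}
      = ∫⁻ b in C, ENNReal.ofReal (1 - rejection μ T b) ^ (m - n) ∂(Measure.pi fun _ => μ) := by
  have hmp := measurePreserving_subTuple_prod μ s hs (card_compl_of_card hs)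
  let A : Set ((Fin n → X) × (Fin (m - n) → X)) := {p | (∀ i, T p.1 (p.2 i)) ∧ p.1 ∈ C}
  have hA : MeasurableSet A := by
    have hA' : MeasurableSet {p : (Fin n → X) × (Fin (m - n) → X) | ∀ i, T p.1 (p.2 i)} := ?_
    · exact hA'.inter (hC.preimage measurable_fst)
    rw [Set.ofPred_forall]
    exact MeasurableSet.iInter fun i =>
      hT.preimage (measurable_fst.prodMk ((measurable_pi_apply i).comp measurable_snd))
  have h1 : {ω | IsCompression T s hs ω ∧ subTuple s hs ω ∈ C} =
      (fun ω : Fin m → X => (subTuple s hs ω, subTuple sᶜ (card_compl_of_card hs) ω)) ⁻¹' A := by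
    ext ω
    simp [A, isCompression_iff]
  rw [h1, hmp.measure_preimage hA.nullMeasurableSet, Measure.prod_apply hA,
    ← lintegral_indicator hC]
  refine lintegral_congr fun b => ?_
  by_cases hb : b ∈ C
  · have : Prod.mk b ⁻¹' A = Set.univ.pi fun _ => {x | T b x} := by
      ext y; simp [A, hb]
    rw [this, Measure.pi_pi, Set.indicator_of_mem hb, Finset.prod_const, measure_accept μ hT b,
      Finset.card_univ, Fintype.card_fin]
  · have : Prod.mk b ⁻¹' A = ∅ := by
      ext y; simp [A, hb]
    rw [this, Set.indicator_of_notMem hb, measure_empty]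

/-- If almost every sample has at most one compression, then the probability that it has one whose
rejection probability lies in `C` is given by the law of the rejection probability. -/
theorem measure_exists_isCompression (hT : MeasurableSet {p : (Fin n → X) × X | T p.1 p.2})
    (hU : ∀ᵐ ω ∂(Measure.pi fun _ : Fin m => μ), ∀ s s' : Finset (Fin m), ∀ (hs : s.card = n)
      (hs' : s'.card = n), IsCompression T s hs ω → IsCompression T s' hs' ω → s = s')
    {C : Set ℝ} (hC : MeasurableSet C) :
    (Measure.pi fun _ : Fin m => μ) {ω | ∃ (s : Finset (Fin m)) (hs : s.card = n),
      IsCompression T s hs ω ∧ rejection μ T (subTuple s hs ω) ∈ C}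
      = (m.choose n : ℝ≥0∞) * ∫⁻ a in C, ENNReal.ofReal (1 - a) ^ (m - n)
        ∂((Measure.pi fun _ : Fin n => μ).map (rejection μ T)) := by
  have hr := measurable_rejection μ hT
  have h1 : {ω | ∃ (s : Finset (Fin m)) (hs : s.card = n),
      IsCompression T s hs ω ∧ rejection μ T (subTuple s hs ω) ∈ C} =
      ⋃ s : {s : Finset (Fin m) // s.card = n},
        {ω | IsCompression T s.1 s.2 ω ∧ subTuple s.1 s.2 ω ∈ rejection μ T ⁻¹' C} := by
    ext ω
    simp
  -- Uniqueness makes the events for different subsets disjoint up to null sets, so the C(m,n) equal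
  -- probabilities simply add up.
  have hdisj : Pairwise (Function.onFun (AEDisjoint (Measure.pi fun _ : Fin m => μ))
      fun s : {s : Finset (Fin m) // s.card = n} =>
        {ω | IsCompression T s.1 s.2 ω ∧ subTuple s.1 s.2 ω ∈ rejection μ T ⁻¹' C}) := by
    intro s s' hss
    refine measure_mono_null ?_ hU
    rintro ω ⟨h1, h2⟩ h
    exact hss (Subtype.ext (h s.1 s'.1 s.2 s'.2 h1.1 h2.1))
  rw [h1, measure_iUnion₀ hdisj, tsum_fintype]
  · simp only [measure_isCompression μ hT _ _ (hr hC)]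
    rw [Finset.sum_const, Finset.card_univ, Fintype.card_finset_len, Fintype.card_fin,
      nsmul_eq_mul, setLIntegral_map hC (by fun_prop) hr]
  · intro s
    exact ((measurableSet_isCompression hT _ _).inter
      ((hr hC).preimage (measurable_subTuple _ _))).nullMeasurableSet

theorem map_rejection_compl (hT : MeasurableSet {p : (Fin n → X) × X | T p.1 p.2}) :
    (Measure.pi fun _ : Fin n => μ).map (rejection μ T) (Set.Icc 0 1)ᶜ = 0 := by
  rw [Measure.map_apply (measurable_rejection μ hT) measurableSet_Icc.compl]
  have : rejection μ T ⁻¹' (Set.Icc 0 1)ᶜ = ∅ := by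
    ext b; simpa using rejection_mem_Icc μ b
  rw [this, measure_empty]

/-- If almost every sample has a compression, and only one, then the law of the rejection
probability satisfies the moment identities of the law `maxUniformLaw`. -/
theorem choose_mul_lintegral_map_rejection
    (hT : MeasurableSet {p : (Fin n → X) × X | T p.1 p.2})
    (hE : ∀ᵐ ω ∂(Measure.pi fun _ : Fin m => μ), ∃ (s : Finset (Fin m)) (hs : s.card = n),
      IsCompression T s hs ω)
    (hU : ∀ᵐ ω ∂(Measure.pi fun _ : Fin m => μ), ∀ s s' : Finset (Fin m), ∀ (hs : s.card = n)
      (hs' : s'.card = n), IsCompression T s hs ω → IsCompression T s' hs' ω → s = s') :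
    (m.choose n : ℝ≥0∞) * ∫⁻ a, ENNReal.ofReal (1 - a) ^ (m - n)
        ∂((Measure.pi fun _ : Fin n => μ).map (rejection μ T)) = 1 := by
  have h := measure_exists_isCompression μ hT hU (C := Set.univ) MeasurableSet.univ
  rw [Measure.restrict_univ] at h
  rw [← h, ← measure_univ (μ := Measure.pi fun _ : Fin m => μ)]
  refine measure_congr (Filter.eventuallyEq_univ.2 ?_)
  filter_upwards [hE] with ω ⟨s, hs, h⟩ using ⟨s, hs, h, Set.mem_univ _⟩

/-- Sample size n + k fixes the k-th moment of 1 - a, and the Beta law satisfies the same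
identities; moments determine a law on [0, 1]. -/
theorem map_rejection_eq_maxUniformLaw (hT : MeasurableSet {p : (Fin n → X) × X | T p.1 p.2})
    (hE : ∀ m, n ≤ m → ∀ᵐ ω ∂(Measure.pi fun _ : Fin m => μ),
      ∃ (s : Finset (Fin m)) (hs : s.card = n), IsCompression T s hs ω)
    (hU : ∀ m, ∀ᵐ ω ∂(Measure.pi fun _ : Fin m => μ), ∀ s s' : Finset (Fin m),
      ∀ (hs : s.card = n) (hs' : s'.card = n),
      IsCompression T s hs ω → IsCompression T s' hs' ω → s = s') :
    (Measure.pi fun _ : Fin n => μ).map (rejection μ T) = maxUniformLaw n := by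
  have := Measure.isProbabilityMeasure_map (μ := Measure.pi fun _ : Fin n => μ)
    (measurable_rejection μ hT).aemeasurable
  refine ext_of_lintegral_one_sub_pow (map_rejection_compl μ hT) (maxUniformLaw_compl n)
    fun k => ?_
  have h1 := choose_mul_lintegral_map_rejection μ hT (hE (n + k) (by omega)) (hU (n + k))
  have h2 := choose_mul_lintegral_maxUniformLaw (show n ≤ n + k by omega)
  rw [Nat.add_sub_cancel_left] at h1 h2
  have h0 : ((n + k).choose n : ℝ≥0∞) ≠ 0 := by
    exact_mod_cast (Nat.choose_pos (by omega)).ne'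
  exact (ENNReal.mul_right_inj h0 (ENNReal.natCast_ne_top _)).1 (h1.trans h2.symm)

theorem measure_exists_isCompression_le (hT : MeasurableSet {p : (Fin n → X) × X | T p.1 p.2})
    (hmap : (Measure.pi fun _ : Fin n => μ).map (rejection μ T) = maxUniformLaw n)
    (hm : n ≤ m)
    (hU : ∀ᵐ ω ∂(Measure.pi fun _ : Fin m => μ), ∀ s s' : Finset (Fin m), ∀ (hs : s.card = n)
      (hs' : s'.card = n), IsCompression T s hs ω → IsCompression T s' hs' ω → s = s')
    {ε : ℝ} (hε : ε ∈ Set.Icc (0 : ℝ) 1) :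
    (Measure.pi fun _ : Fin m => μ) {ω | ∃ (s : Finset (Fin m)) (hs : s.card = n),
      IsCompression T s hs ω ∧ rejection μ T (subTuple s hs ω) ≤ ε}
      = ENNReal.ofReal (binomTail n m ε) := by
  have h := measure_exists_isCompression μ hT hU (measurableSet_Iic (a := ε))
  rw [hmap, choose_mul_setLIntegral_maxUniformLaw hm hε] at h
  exact h

end Samples

end

/-! ### Strictly convex minimisation, Helly's theorem and lowest-label completions. -/

noncomputable section

section Argmin

variable {E : Type*}

open Classical in
/-- A minimiser of `g` on `F` (and `0` if there is none). -/
def argminOn [Zero E] (g : E → ℝ) (F : Set E) : E :=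
  if h : ∃ θ ∈ F, ∀ θ' ∈ F, g θ ≤ g θ' then h.choose else 0

variable [NormedAddCommGroup E] {g : E → ℝ} {F : Set E}

theorem argminOn_spec (hg : Continuous g) (hF : IsCompact F) (hne : F.Nonempty) :
    argminOn g F ∈ F ∧ ∀ θ ∈ F, g (argminOn g F) ≤ g θ := by
  have h : ∃ θ ∈ F, ∀ θ' ∈ F, g θ ≤ g θ' := hF.exists_isMinOn hne hg.continuousOn
  rw [argminOn, dif_pos h]
  exact h.choose_spec

theorem argminOn_empty : argminOn g ∅ = 0 := by
  rw [argminOn, dif_neg (by simp)]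

variable [NormedSpace ℝ E]

theorem StrictConvexOn.lt_of_le_of_ne (hs : StrictConvexOn ℝ Set.univ g) {x y : E} (h : g y ≤ g x)
    (hne : y ≠ x) {t : ℝ} (ht0 : 0 < t) (ht1 : t < 1) : g ((1 - t) • x + t • y) < g x := by
  have := hs.2 (Set.mem_univ x) (Set.mem_univ y) hne.symm (sub_pos.2 ht1) ht0 (by ring)
  simp only [smul_eq_mul] at this
  nlinarith

/-- Otherwise the midpoint of two distinct minimisers would be feasible and strictly better. -/
theorem eq_argminOn (hg : Continuous g) (hs : StrictConvexOn ℝ Set.univ g) (hF : IsCompact F)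
    (hc : Convex ℝ F) {θ : E} (hθ : θ ∈ F) (hle : g θ ≤ g (argminOn g F)) :
    θ = argminOn g F := by
  obtain ⟨h1, h2⟩ := argminOn_spec hg hF ⟨θ, hθ⟩
  by_contra hne
  have h3 := hs.lt_of_le_of_ne hle hne (t := 1 / 2) (by norm_num) (by norm_num)
  have h4 := h2 _ (hc h1 hθ (by norm_num : (0 : ℝ) ≤ 1 - 1 / 2) (by norm_num : (0 : ℝ) ≤ 1 / 2)
    (by norm_num))
  exact absurd h3 (not_lt.2 h4)

end Argmin

section Helly

variable {E ι : Type*} [AddCommGroup E] [Module ℝ E] [FiniteDimensional ℝ E]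

/-- If the convex set `D` misses the nonempty intersection of the convex sets `K i`, then it misses
the intersection of at most `dim E` of them. -/
theorem exists_card_le_finrank_disjoint {D : Set E} (hD : Convex ℝ D) {K : ι → Set E}
    {s : Finset ι} (hK : ∀ i ∈ s, Convex ℝ (K i)) (hne : (⋂ i ∈ s, K i).Nonempty)
    (hdisj : ∀ x ∈ D, ∃ i ∈ s, x ∉ K i) :
    ∃ B ⊆ s, B.card ≤ Module.finrank ℝ E ∧ ∀ x ∈ D, ∃ i ∈ B, x ∉ K i := by
  classical
  by_contra hcon
  push Not at hcon
  -- Helly for the family with D adjoined as index `none`. A subfamily containing D has at most dim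
  -- E other members and is handled by the contrary assumption; one without D meets because the
  -- whole intersection is nonempty.
  let F : Option ι → Set E := fun o => o.elim D K
  have hF : (⋂ o ∈ Finset.insertNone s, F o).Nonempty := by
    refine Convex.helly_theorem' (𝕜 := ℝ) ?_ ?_
    · rintro (_ | i) hi
      · exact hD
      · exact hK i (by simpa using hi)
    · intro I hI hcard
      have hsub : Finset.eraseNone I ⊆ s := fun i hi => by
        have := hI (Finset.mem_eraseNone.1 hi)
        simpa using this
      by_cases hnone : none ∈ I
      · obtain ⟨x, hx, hxB⟩ := hcon (Finset.eraseNone I) hsub (by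
          have h1 : (Finset.insertNone (Finset.eraseNone I)).card = I.card := by
            rw [Finset.insertNone_eraseNone, Finset.insert_eq_self.2 hnone]
          rw [Finset.card_insertNone] at h1
          omega)
        refine ⟨x, Set.mem_iInter₂.2 ?_⟩
        rintro (_ | i) hi
        · exact hx
        · exact hxB i (Finset.mem_eraseNone.2 hi)
      · obtain ⟨x, hx⟩ := hne
        refine ⟨x, Set.mem_iInter₂.2 ?_⟩
        rintro (_ | i) hi
        · exact absurd hi hnone
        · exact Set.mem_iInter₂.1 hx i (hsub (Finset.mem_eraseNone.2 hi))
  obtain ⟨x, hx⟩ := hF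
  rw [Set.mem_iInter₂] at hx
  obtain ⟨i, hi, hxi⟩ := hdisj x (hx none (by simp))
  exact hxi (hx (some i) (by simpa using hi))

end Helly

/-- Completing `B` to an `n`-element set by the elements with the lowest labels. -/
theorem exists_lowest_completion {ι : Type*} [Fintype ι] [DecidableEq ι] {lab : ι → ℝ}
    (hlab : Function.Injective lab) {B : Finset ι} {n : ℕ} (hB : B.card ≤ n)
    (hn : n ≤ Fintype.card ι) :
    ∃ s : Finset ι, s.card = n ∧ B ⊆ s ∧ ∀ i ∈ s, i ∉ B → ∀ j ∉ s, lab i < lab j := by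
  let C := (Finset.univ : Finset (Finset ι)).filter fun s => s.card = n ∧ B ⊆ s
  have hC : C.Nonempty := by
    obtain ⟨s, hBs, -, hs⟩ := Finset.exists_subsuperset_card_eq (Finset.subset_univ B) hB
      (by simpa using hn)
    exact ⟨s, by simp [C, hs, hBs]⟩
  -- Minimise the sum of labels: if an added element had a larger label than an element left out,
  -- swapping the two would lower the sum.
  obtain ⟨s, hs, hmin⟩ := C.exists_min_image (fun s => ∑ i ∈ s, lab i) hC
  obtain ⟨hcard, hBs⟩ := (Finset.mem_filter.1 hs).2
  refine ⟨s, hcard, hBs, fun i hi hiB j hj => ?_⟩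
  by_contra hlt
  have hne : j ≠ i := fun h => hj (h ▸ hi)
  have hlt' : lab j < lab i := lt_of_le_of_ne (not_lt.1 hlt) (hlab.ne hne)
  have hj' : j ∉ s.erase i := fun h => hj (Finset.mem_of_mem_erase h)
  have hmem : insert j (s.erase i) ∈ C := by
    refine Finset.mem_filter.2 ⟨Finset.mem_univ _, ?_, ?_⟩
    · rw [Finset.card_insert_of_notMem hj', Finset.card_erase_add_one hi, hcard]
    · intro b hb
      exact Finset.mem_insert_of_mem (Finset.mem_erase.2 ⟨fun h => hiB (h ▸ hb), hBs hb⟩)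
  have h1 := hmin _ hmem
  rw [Finset.sum_insert hj'] at h1
  have h2 := Finset.add_sum_erase s lab hi
  linarith

/-- If the sets differ, equal cardinality provides i in s only and j in s' only; both lie outside B,
and each would have the smaller label. -/
theorem lowest_completion_unique {ι : Type*} {lab : ι → ℝ} {B s s' : Finset ι}
    (hcard : s.card = s'.card) (hB : B ⊆ s) (hB' : B ⊆ s')
    (hs : ∀ i ∈ s, i ∉ B → ∀ j ∉ s, lab i < lab j)
    (hs' : ∀ i ∈ s', i ∉ B → ∀ j ∉ s', lab i < lab j) : s = s' := by
  by_contra hne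
  have h1 : ¬ s ⊆ s' := fun h => hne (Finset.eq_of_subset_of_card_le h hcard.ge)
  have h2 : ¬ s' ⊆ s := fun h => hne (Finset.eq_of_subset_of_card_le h hcard.le).symm
  obtain ⟨i, hi, hi'⟩ := Finset.not_subset.1 h1
  obtain ⟨j, hj, hj'⟩ := Finset.not_subset.1 h2
  exact lt_asymm (hs i hi (fun h => hi' (hB' h)) j hj') (hs' j hj (fun h => hj' (hB h)) i hi')

/-! ### Bases and compressions of a fixed scenario instance. -/

namespace ScenarioProblem

variable {n m : ℕ} {X : Type*}

/-- The scenario problem has a compact convex domain and convex constraints. -/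
structure IsConvex (S : ScenarioProblem n X) : Prop where
  convex : Convex ℝ S.Θ
  compact : IsCompact S.Θ
  convexOn : ∀ x, ConvexOn ℝ Set.univ fun θ => S.f θ x

variable {S : ScenarioProblem n X} {ω : Fin m → X} {I J K : Finset (Fin m)}

theorem IsConvex.continuous (hS : S.IsConvex) (x : X) : Continuous fun θ => S.f θ x :=
  (hS.convexOn x).locallyLipschitz.continuous

theorem IsConvex.convex_setOf (hS : S.IsConvex) (x : X) : Convex ℝ {θ | S.f θ x ≤ 0} := by
  simpa using (hS.convexOn x).convex_le 0

theorem feasible_eq (S : ScenarioProblem n X) (ω : Fin m → X) (I : Finset (Fin m)) :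
    S.feasible ω I = S.Θ ∩ ⋂ i ∈ I, {θ | S.f θ (ω i) ≤ 0} := by
  ext θ; simp [feasible]

theorem feasible_anti (h : I ⊆ J) : S.feasible ω J ⊆ S.feasible ω I :=
  fun _ hθ => ⟨hθ.1, fun i hi => hθ.2 i (h hi)⟩

theorem feasible_nonempty_of_univ (h : (S.feasible ω Finset.univ).Nonempty) :
    (S.feasible ω I).Nonempty :=
  h.mono (feasible_anti (Finset.subset_univ I))

theorem IsConvex.convex_feasible (hS : S.IsConvex) : Convex ℝ (S.feasible ω I) := by
  rw [feasible_eq]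
  exact hS.convex.inter (convex_iInter₂ fun i _ => hS.convex_setOf _)

theorem IsConvex.isCompact_feasible (hS : S.IsConvex) : IsCompact (S.feasible ω I) := by
  rw [feasible_eq]
  exact hS.compact.inter_right (isClosed_biInter fun i _ =>
    isClosed_le (hS.continuous _) continuous_const)

theorem feasible_subTuple {k : ℕ} (s : Finset (Fin m)) (hs : s.card = k) (I : Finset (Fin k)) :
    S.feasible (subTuple s hs ω) I = S.feasible ω (I.map (s.orderEmbOfFin hs).toEmbedding) := by
  ext θ; simp [feasible, subTuple]

theorem map_univ_orderEmbOfFin {k : ℕ} (s : Finset (Fin m)) (hs : s.card = k) :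
    Finset.univ.map (s.orderEmbOfFin hs).toEmbedding = s := by
  ext j
  simp only [Finset.mem_map, Finset.mem_univ, true_and]
  refine ⟨?_, fun hj => exists_orderEmbOfFin_eq hs hj⟩
  rintro ⟨i, rfl⟩
  exact Finset.orderEmbOfFin_mem s hs i

theorem feasible_subTuple_univ {k : ℕ} (s : Finset (Fin m)) (hs : s.card = k) :
    S.feasible (subTuple s hs ω) Finset.univ = S.feasible ω s := by
  rw [feasible_subTuple, map_univ_orderEmbOfFin]

theorem feasible_subTuple_erase {k : ℕ} (s : Finset (Fin m)) (hs : s.card = k) (i : Fin k) :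
    S.feasible (subTuple s hs ω) (Finset.univ.erase i)
      = S.feasible ω (s.erase (s.orderEmbOfFin hs i)) := by
  rw [feasible_subTuple, Finset.map_erase, map_univ_orderEmbOfFin]
  rfl

/-- Helly's theorem: the scenario problem is feasible if all its subproblems with `n + 1` scenarios
are. -/
theorem IsConvex.feasible_nonempty (hS : S.IsConvex) (hm : n + 1 ≤ m)
    (h : ∀ s : Finset (Fin m), s.card = n + 1 → (S.feasible ω s).Nonempty) :
    (S.feasible ω Finset.univ).Nonempty := by
  -- Θ is intersected into every set instead of being a further member of the family, so subproblems
  -- with n + 1 scenarios suffice.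
  have := Convex.helly_theorem (𝕜 := ℝ) (s := (Finset.univ : Finset (Fin m)))
    (F := fun i => S.Θ ∩ {θ | S.f θ (ω i) ≤ 0}) (by simpa using hm)
    (fun i _ => hS.convex.inter (hS.convex_setOf _)) (by
      intro I _ hI
      obtain ⟨θ, hθ⟩ := h I (by simpa using hI)
      exact ⟨θ, Set.mem_iInter₂.2 fun i hi => ⟨hθ.1, hθ.2 i hi⟩⟩)
  obtain ⟨θ, hθ⟩ := this
  rw [Set.mem_iInter₂] at hθ
  exact ⟨θ, (hθ ⟨0, by omega⟩ (Finset.mem_univ _)).1, fun i hi => (hθ i hi).2⟩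

/-- The minimiser of `g` under the scenario constraints with indices in `I`. -/
def minimizer (S : ScenarioProblem n X) (g : EuclideanSpace ℝ (Fin n) → ℝ) (ω : Fin m → X)
    (I : Finset (Fin m)) : EuclideanSpace ℝ (Fin n) :=
  argminOn g (S.feasible ω I)

variable {g : EuclideanSpace ℝ (Fin n) → ℝ}

section Minimizer

variable (hS : S.IsConvex) (hg : Continuous g) (hs : StrictConvexOn ℝ Set.univ g)
include hS hg

theorem minimizer_mem (hne : (S.feasible ω I).Nonempty) : S.minimizer g ω I ∈ S.feasible ω I :=
  (argminOn_spec hg hS.isCompact_feasible hne).1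

theorem minimizer_le {θ : EuclideanSpace ℝ (Fin n)} (hθ : θ ∈ S.feasible ω I) :
    g (S.minimizer g ω I) ≤ g θ :=
  (argminOn_spec hg hS.isCompact_feasible ⟨θ, hθ⟩).2 θ hθ

include hs

theorem eq_minimizer {θ : EuclideanSpace ℝ (Fin n)} (hθ : θ ∈ S.feasible ω I)
    (hle : g θ ≤ g (S.minimizer g ω I)) : θ = S.minimizer g ω I :=
  eq_argminOn hg hs hS.isCompact_feasible hS.convex_feasible hθ hle

theorem minimizer_eq_of_mem (hIJ : I ⊆ J) (h : S.minimizer g ω I ∈ S.feasible ω J) :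
    S.minimizer g ω I = S.minimizer g ω J :=
  eq_minimizer hS hg hs h (minimizer_le hS hg
    (feasible_anti hIJ (minimizer_mem hS hg ⟨_, h⟩)))

/-- Minimal values grow with the constraint set, so all three coincide, and strict convexity turns
equal values into equal minimisers. -/
theorem minimizer_sandwich (hne : (S.feasible ω K).Nonempty) (hIJ : I ⊆ J) (hJK : J ⊆ K)
    (h : S.minimizer g ω I = S.minimizer g ω K) : S.minimizer g ω J = S.minimizer g ω K := by
  have hK := minimizer_mem hS hg hne
  refine (eq_minimizer hS hg hs (feasible_anti hJK hK) ?_).symm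
  rw [← h]
  exact minimizer_le hS hg (feasible_anti hIJ (minimizer_mem hS hg
    (hne.mono (feasible_anti hJK))))

/-- The points of Θ strictly better than the optimum form a convex set that the constraints jointly
exclude; by Helly at most n of them already exclude it. -/
theorem exists_basis (hne : (S.feasible ω Finset.univ).Nonempty) :
    ∃ B : Finset (Fin m), B.card ≤ n ∧ S.minimizer g ω B = S.minimizer g ω Finset.univ := by
  have hD : Convex ℝ {θ | θ ∈ S.Θ ∧ g θ < g (S.minimizer g ω Finset.univ)} := by
    have := hS.convex.inter (hs.convexOn.convex_lt (g (S.minimizer g ω Finset.univ)))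
    simpa [Set.inter_def] using this
  obtain ⟨B, -, hBc, hB⟩ := exists_card_le_finrank_disjoint hD (s := Finset.univ)
    (K := fun i => {θ | S.f θ (ω i) ≤ 0}) (fun i _ => hS.convex_setOf _) (by
      rw [feasible_eq] at hne
      exact hne.mono Set.inter_subset_right) (by
      rintro θ ⟨h1, h2⟩
      by_contra hcon
      push Not at hcon
      exact absurd (minimizer_le hS hg (I := Finset.univ) (ω := ω)
        ⟨h1, fun i hi => hcon i hi⟩) (not_le.2 h2))
  refine ⟨B, by simpa using hBc, ?_⟩
  have hB' := minimizer_mem hS hg (hne.mono (feasible_anti (Finset.subset_univ B)))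
  have hle : g (S.minimizer g ω Finset.univ) ≤ g (S.minimizer g ω B) := by
    by_contra hlt
    obtain ⟨i, hi, hin⟩ := hB _ ⟨hB'.1, not_le.1 hlt⟩
    exact hin (hB'.2 i hi)
  exact (eq_minimizer hS hg hs (feasible_anti (Finset.subset_univ B) (minimizer_mem hS hg hne))
    hle).symm

end Minimizer

/-- The instance `ω` is nondegenerate: labels are distinct, and problems that share the solution
share their essential constraints. -/
structure Nondegenerate (S : ScenarioProblem n X) (g : EuclideanSpace ℝ (Fin n) → ℝ) (lab : X → ℝ)
    (ω : Fin m → X) : Prop where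
  nonempty : (S.feasible ω Finset.univ).Nonempty
  injective : Function.Injective fun i => lab (ω i)
  ne : ∀ (i : Fin m) (I J : Finset (Fin m)), i ∈ I → i ∉ J →
    S.minimizer g ω (I.erase i) ≠ S.minimizer g ω I → S.minimizer g ω I ≠ S.minimizer g ω J

/-- The sample `b` accepts `x` if its solution satisfies the constraint `x`, and the label of `x`
exceeds those of the inessential elements of `b`. -/
def Accepts (S : ScenarioProblem n X) (g : EuclideanSpace ℝ (Fin n) → ℝ) (lab : X → ℝ)
    (b : Fin n → X) (x : X) : Prop :=
  S.f (S.minimizer g b Finset.univ) x ≤ 0 ∧ ∀ i : Fin n,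
    S.minimizer g b (Finset.univ.erase i) = S.minimizer g b Finset.univ → lab (b i) < lab x

theorem isCompression_accepts_iff (lab : X → ℝ) (s : Finset (Fin m)) (hcard : s.card = n) :
    IsCompression (S.Accepts g lab) s hcard ω ↔ ∀ j ∉ s, S.f (S.minimizer g ω s) (ω j) ≤ 0 ∧
      ∀ i ∈ s, S.minimizer g ω (s.erase i) = S.minimizer g ω s → lab (ω i) < lab (ω j) := by
  refine forall₂_congr fun j _ => ?_
  simp only [Accepts, minimizer, feasible_subTuple_univ, feasible_subTuple_erase]
  refine and_congr_right fun _ => ⟨fun h i hi => ?_, fun h i => ?_⟩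
  · obtain ⟨i, rfl⟩ := exists_orderEmbOfFin_eq hcard hi
    exact h i
  · exact h _ (Finset.orderEmbOfFin_mem s hcard i)

section Compression

variable (hS : S.IsConvex) (hg : Continuous g) (hs : StrictConvexOn ℝ Set.univ g) {lab : X → ℝ}
include hS hg hs

theorem minimizer_eq_of_isCompression (hne : (S.feasible ω Finset.univ).Nonempty)
    {s : Finset (Fin m)} {hcard : s.card = n} (h : IsCompression (S.Accepts g lab) s hcard ω) :
    S.minimizer g ω s = S.minimizer g ω Finset.univ := by
  refine minimizer_eq_of_mem hS hg hs (Finset.subset_univ s) ?_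
  have hm := minimizer_mem hS hg (hne.mono (feasible_anti (Finset.subset_univ s)))
  refine ⟨hm.1, fun j _ => ?_⟩
  by_cases hj : j ∈ s
  · exact hm.2 j hj
  · exact ((isCompression_accepts_iff lab s hcard).1 h j hj).1

/-- Take B of least cardinality with the full solution. Each of its constraints is then essential,
and nondegeneracy puts it into every J with the same solution; the converse is the sandwich
property. -/
theorem Nondegenerate.exists_basis (h : S.Nondegenerate g lab ω) :
    ∃ B : Finset (Fin m), B.card ≤ n ∧
      ∀ J, S.minimizer g ω J = S.minimizer g ω Finset.univ ↔ B ⊆ J := by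
  let C := (Finset.univ : Finset (Finset (Fin m))).filter fun J =>
    S.minimizer g ω J = S.minimizer g ω Finset.univ
  obtain ⟨B₀, hB₀, hB₀'⟩ := ScenarioProblem.exists_basis hS hg hs h.nonempty
  obtain ⟨B, hB, hmin⟩ := C.exists_min_image Finset.card ⟨B₀, by simp [C, hB₀']⟩
  have hB' := (Finset.mem_filter.1 hB).2
  refine ⟨B, (hmin B₀ (by simp [C, hB₀'])).trans hB₀, fun J => ⟨fun hJ i hi => ?_, fun hJ => ?_⟩⟩
  · by_contra hiJ
    refine h.ne i B J hi hiJ (fun he => ?_) (hB'.trans hJ.symm)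
    have := hmin (B.erase i) (by simp [C, he, hB'])
    have := Finset.card_erase_lt_of_mem hi
    omega
  · exact minimizer_sandwich hS hg hs h.nonempty hJ (Finset.subset_univ J) hB'

/-- For s with the full solution, the inessential elements are exactly those outside B. So
acceptance by the solution amounts to B ⊆ s, and the label condition to s being the lowest
completion of B. -/
theorem Nondegenerate.isCompression_iff (h : S.Nondegenerate g lab ω) {B : Finset (Fin m)}
    (hB : ∀ J, S.minimizer g ω J = S.minimizer g ω Finset.univ ↔ B ⊆ J) (s : Finset (Fin m))
    (hcard : s.card = n) :
    IsCompression (S.Accepts g lab) s hcard ω ↔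
      B ⊆ s ∧ ∀ i ∈ s, i ∉ B → ∀ j ∉ s, lab (ω i) < lab (ω j) := by
  constructor
  · intro hcomp
    have h1 := minimizer_eq_of_isCompression hS hg hs h.nonempty hcomp
    have hBs := (hB s).1 h1
    refine ⟨hBs, fun i hi hiB j hj => ?_⟩
    refine ((isCompression_accepts_iff lab s hcard).1 hcomp j hj).2 i hi ?_
    rw [h1]
    exact (hB _).2 fun b hb => Finset.mem_erase.2 ⟨fun e => hiB (e ▸ hb), hBs hb⟩
  · rintro ⟨hBs, hlow⟩
    rw [isCompression_accepts_iff]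
    have h1 := (hB s).2 hBs
    refine fun j hj => ⟨?_, fun i hi he => hlow i hi (fun hiB => ?_) j hj⟩
    · rw [h1]
      exact (minimizer_mem hS hg h.nonempty).2 j (Finset.mem_univ j)
    · have := (hB _).1 (he.trans h1) hiB
      exact absurd this (Finset.notMem_erase i s)

theorem Nondegenerate.exists_isCompression (h : S.Nondegenerate g lab ω) (hm : n ≤ m) :
    ∃ (s : Finset (Fin m)) (hcard : s.card = n), IsCompression (S.Accepts g lab) s hcard ω := by
  obtain ⟨B, hBc, hB⟩ := h.exists_basis hS hg hs
  obtain ⟨s, hcard, h1, h2⟩ := exists_lowest_completion h.injective hBc (by simpa using hm)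
  exact ⟨s, hcard, (h.isCompression_iff hS hg hs hB s hcard).2 ⟨h1, h2⟩⟩

theorem Nondegenerate.isCompression_unique (h : S.Nondegenerate g lab ω) {s s' : Finset (Fin m)}
    {hcard : s.card = n} {hcard' : s'.card = n} (h1 : IsCompression (S.Accepts g lab) s hcard ω)
    (h2 : IsCompression (S.Accepts g lab) s' hcard' ω) : s = s' := by
  obtain ⟨B, hBc, hB⟩ := h.exists_basis hS hg hs
  rw [h.isCompression_iff hS hg hs hB] at h1 h2
  exact lowest_completion_unique (hcard.trans hcard'.symm) h1.1 h2.1 h1.2 h2.2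

/-- Relaxing an essential constraint changes the solution, so that coincidences between solutions
are destroyed. -/
theorem minimizer_ne_of_relax {ω ω' : Fin m → X} {i : Fin m} (hoff : ∀ j ≠ i, ω' j = ω j)
    (hlt : ∀ θ, S.f θ (ω' i) < S.f θ (ω i)) (hne : (S.feasible ω Finset.univ).Nonempty)
    (hi : i ∈ I) (hiJ : i ∉ J) (h1 : S.minimizer g ω (I.erase i) ≠ S.minimizer g ω I)
    (h2 : S.minimizer g ω I = S.minimizer g ω J) : S.minimizer g ω' I ≠ S.minimizer g ω' J := by
  intro h3
  have hfeas : ∀ A : Finset (Fin m), i ∉ A → S.feasible ω' A = S.feasible ω A := by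
    intro A hA
    ext θ
    refine and_congr_right fun _ => forall₂_congr fun j hj => ?_
    rw [hoff j fun h => hA (h ▸ hj)]
  -- Problem J does not see constraint i, so a coincidence under ω' as well would leave the solution
  -- of I where it was.
  have h4 : S.minimizer g ω' I = S.minimizer g ω I := by
    rw [h3, h2, minimizer, minimizer, hfeas J hiJ]
  set θ := S.minimizer g ω I
  set θ₀ := S.minimizer g ω (I.erase i)
  have hθ : θ ∈ S.feasible ω I := minimizer_mem hS hg (feasible_nonempty_of_univ hne)
  have hθ₀ : θ₀ ∈ S.feasible ω (I.erase i) := minimizer_mem hS hg (feasible_nonempty_of_univ hne)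
  have hle : g θ₀ ≤ g θ := minimizer_le hS hg (feasible_anti (Finset.erase_subset i I) hθ)
  have hcont : Filter.Tendsto (fun t : ℝ => S.f ((1 - t) • θ + t • θ₀) (ω' i)) (nhds 0)
      (nhds (S.f θ (ω' i))) := by
    have : Continuous fun t : ℝ => S.f ((1 - t) • θ + t • θ₀) (ω' i) :=
      (hS.continuous (ω' i)).comp (by fun_prop)
    simpa using this.tendsto 0
  -- After relaxation the old solution has slack in constraint i, so a small step towards θ₀ remains
  -- feasible and strictly lowers g.
  have hneg : S.f θ (ω' i) < 0 := (hlt θ).trans_le (hθ.2 i hi)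
  have hev : ∀ᶠ t : ℝ in nhdsWithin 0 (Set.Ioi 0), S.f ((1 - t) • θ + t • θ₀) (ω' i) < 0 :=
    (hcont.eventually_lt_const hneg).filter_mono nhdsWithin_le_nhds
  have hev1 : ∀ᶠ t : ℝ in nhdsWithin 0 (Set.Ioi 0), t ∈ Set.Ioo (0 : ℝ) 1 :=
    Ioo_mem_nhdsGT one_pos
  obtain ⟨t, ht, ht0, ht1⟩ := (hev.and hev1).exists
  have hmem : (1 - t) • θ + t • θ₀ ∈ S.feasible ω (I.erase i) :=
    hS.convex_feasible (feasible_anti (Finset.erase_subset i I) hθ) hθ₀ (sub_pos.2 ht1).le ht0.le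
      (by ring)
  have hmem' : (1 - t) • θ + t • θ₀ ∈ S.feasible ω' I := by
    refine ⟨hmem.1, fun j hj => ?_⟩
    by_cases hji : j = i
    · rw [hji]; exact ht.le
    · rw [hoff j hji]; exact hmem.2 j (Finset.mem_erase.2 ⟨hji, hj⟩)
  have h5 := minimizer_le hS hg hmem'
  rw [h4] at h5
  exact absurd (hs.lt_of_le_of_ne hle h1 ht0 ht1) (not_lt.2 h5)

end Compression

end ScenarioProblem

end

/-! ### Measurability of feasibility and of minimisers. -/

noncomputable section

section CompactExists

variable {E Ω : Type*} [MetricSpace E] [MeasurableSpace Ω] {K : Set E} {φ : E → Ω → ℝ}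

/-- By compactness and continuity the existence of such a point is a bound on an infimum, which can
be tested on a countable dense subset. -/
theorem measurableSet_exists_mem_le (hK : IsCompact K) (hc : ∀ ω, Continuous fun θ => φ θ ω)
    (hm : ∀ θ, Measurable (φ θ)) : MeasurableSet {ω | ∃ θ ∈ K, φ θ ω ≤ 0} := by
  rcases K.eq_empty_or_nonempty with rfl | hne
  · simp
  have : CompactSpace K := isCompact_iff_compactSpace.1 hK
  have : Nonempty K := hne.to_subtype
  have hset : {ω | ∃ θ ∈ K, φ θ ω ≤ 0} =
      ⋂ k : ℕ, ⋃ j : ℕ, {ω | φ (TopologicalSpace.denseSeq K j) ω < 1 / ((k : ℝ) + 1)} := by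
    ext ω
    simp only [Set.mem_iInter, Set.mem_iUnion, Set.mem_ofPred_eq]
    constructor
    · rintro ⟨θ, hθ, hle⟩ k
      have ho : IsOpen {x : K | φ x ω < 1 / ((k : ℝ) + 1)} :=
        isOpen_lt ((hc ω).comp continuous_subtype_val) continuous_const
      have hpos : (0 : ℝ) < 1 / ((k : ℝ) + 1) := Nat.one_div_pos_of_nat
      exact (TopologicalSpace.denseRange_denseSeq K).exists_mem_open ho
        ⟨⟨θ, hθ⟩, hle.trans_lt hpos⟩
    · intro h
      obtain ⟨θ, hθ, hmin⟩ := hK.exists_isMinOn hne (hc ω).continuousOn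
      refine ⟨θ, hθ, le_of_forall_pos_le_add fun e he => ?_⟩
      obtain ⟨k, hk⟩ := exists_nat_one_div_lt he
      obtain ⟨j, hj⟩ := h k
      have := hmin (TopologicalSpace.denseSeq K j).2
      have h1 : φ θ ω ≤ φ (TopologicalSpace.denseSeq K j) ω := this
      linarith
  rw [hset]
  exact MeasurableSet.iInter fun k => MeasurableSet.iUnion fun j =>
    measurableSet_lt (hm _) measurable_const

end CompactExists

namespace ScenarioProblem

variable {n m : ℕ} {X : Type*} {S : ScenarioProblem n X}
  {g : EuclideanSpace ℝ (Fin n) → ℝ} {ω : Fin m → X} {I J : Finset (Fin m)}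

/-- Merges finitely many constraints into a single continuous one, the form required by
`measurableSet_exists_mem_le`. -/
theorem sum_posPart_le_zero_iff {θ : EuclideanSpace ℝ (Fin n)} :
    ∑ i ∈ I, max (S.f θ (ω i)) 0 ≤ 0 ↔ ∀ i ∈ I, S.f θ (ω i) ≤ 0 := by
  have h0 : ∀ i ∈ I, 0 ≤ max (S.f θ (ω i)) 0 := fun i _ => le_max_right _ _
  rw [(Finset.sum_nonneg h0).ge_iff_eq', Finset.sum_eq_zero_iff_of_nonneg h0]
  simp

section Measurable

variable [MeasurableSpace X] (hS : S.IsConvex) (hf : ∀ θ, Measurable (S.f θ))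
include hS hf

theorem measurableSet_exists_feasible {C : Set (EuclideanSpace ℝ (Fin n))} (hC : IsClosed C)
    (I : Finset (Fin m)) :
    MeasurableSet {ω : Fin m → X | ∃ θ ∈ C, θ ∈ S.feasible ω I} := by
  have h := measurableSet_exists_mem_le (hS.compact.inter_right hC)
    (φ := fun θ (ω : Fin m → X) => ∑ i ∈ I, max (S.f θ (ω i)) 0)
    (fun ω => continuous_finsetSum _ fun i _ => (hS.continuous _).max continuous_const)
    (fun θ => Finset.measurable_sum _ fun i _ =>
      ((hf θ).comp (measurable_pi_apply i)).max measurable_const)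
  convert h using 3 with ω
  refine exists_congr fun θ => ?_
  rw [sum_posPart_le_zero_iff]
  simp only [feasible, Set.mem_ofPred_eq, Set.mem_inter_iff]
  tauto

theorem measurableSet_feasible_nonempty (I : Finset (Fin m)) :
    MeasurableSet {ω : Fin m → X | (S.feasible ω I).Nonempty} := by
  have h := measurableSet_exists_feasible hS hf isClosed_univ I
  simp only [Set.mem_univ, true_and] at h
  exact h

/-- For a feasible problem the minimiser lies in a closed set C iff every rational level reached by
a feasible point is reached by one in C: letting the level decrease gives a minimiser in C, and
there is only one. Infeasible problems return the default 0. -/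
theorem measurable_minimizer (hg : Continuous g) (hs : StrictConvexOn ℝ Set.univ g)
    (I : Finset (Fin m)) : Measurable fun ω : Fin m → X => S.minimizer g ω I := by
  refine measurable_of_isClosed fun C hC => ?_
  have hset : (fun ω : Fin m → X => S.minimizer g ω I) ⁻¹' C =
      ({ω | (S.feasible ω I).Nonempty} ∩ ⋂ t : ℚ,
        ({ω | ∃ θ ∈ {θ | g θ ≤ t}, θ ∈ S.feasible ω I}ᶜ ∪
          {ω | ∃ θ ∈ C ∩ {θ | g θ ≤ t}, θ ∈ S.feasible ω I})) ∪
      ({ω | (S.feasible ω I).Nonempty}ᶜ ∩ {_ω | (0 : EuclideanSpace ℝ (Fin n)) ∈ C}) := by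
    ext ω
    by_cases hne : (S.feasible ω I).Nonempty
    · have hmem := minimizer_mem hS hg hne
      simp only [Set.mem_preimage, Set.mem_union, Set.mem_inter_iff, Set.mem_ofPred_eq, hne,
        true_and, Set.mem_iInter, Set.mem_compl_iff, not_true_eq_false, false_and, or_false]
      constructor
      · intro hCmem t
        rw [or_iff_not_imp_left, not_not]
        rintro ⟨θ, ht, hθ⟩
        exact ⟨_, ⟨hCmem, (minimizer_le hS hg hθ).trans ht⟩, hmem⟩
      · intro h
        have h' : ∀ t : ℚ, g (S.minimizer g ω I) < t →
            ∃ θ, (θ ∈ C ∧ g θ ≤ t) ∧ θ ∈ S.feasible ω I := fun t ht =>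
          (h t).resolve_left (not_not.2 ⟨_, ht.le, hmem⟩)
        have hcomp : IsCompact (S.feasible ω I ∩ C) := hS.isCompact_feasible.inter_right hC
        have hne' : (S.feasible ω I ∩ C).Nonempty := by
          obtain ⟨t, ht⟩ := exists_rat_gt (g (S.minimizer g ω I))
          obtain ⟨θ, h1, h2⟩ := h' t ht
          exact ⟨θ, h2, h1.1⟩
        obtain ⟨h1, h2⟩ := argminOn_spec hg hcomp hne'
        have h3 : g (argminOn g (S.feasible ω I ∩ C)) ≤ g (S.minimizer g ω I) := by
          by_contra hlt
          obtain ⟨t, ht1, ht2⟩ := exists_rat_btwn (not_le.1 hlt)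
          obtain ⟨θ, h4, h5⟩ := h' t ht1
          exact absurd (h4.2.trans_lt ht2) (not_lt.2 (h2 θ ⟨h5, h4.1⟩))
        rw [← eq_minimizer hS hg hs h1.1 h3]
        exact h1.2
    · have : S.minimizer g ω I = 0 := by
        rw [minimizer, Set.not_nonempty_iff_eq_empty.1 hne, argminOn_empty]
      simp [hne, this]
  have hN := measurableSet_feasible_nonempty hS hf I
  rw [hset]
  refine (hN.inter (MeasurableSet.iInter fun t => ?_)).union (hN.compl.inter (by simp))
  have ht : IsClosed {θ | g θ ≤ t} := isClosed_le hg continuous_const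
  exact (measurableSet_exists_feasible hS hf ht I).compl.union
    (measurableSet_exists_feasible hS hf (hC.inter ht) I)

theorem measurable_uncurry_f :
    Measurable fun p : EuclideanSpace ℝ (Fin n) × X => S.f p.1 p.2 :=
  measurable_uncurry_of_continuous_of_measurable hS.continuous hf

theorem measurableSet_accepts (hg : Continuous g) (hs : StrictConvexOn ℝ Set.univ g) {lab : X → ℝ}
    (hlab : Measurable lab) : MeasurableSet {p : (Fin n → X) × X | S.Accepts g lab p.1 p.2} := by
  have hmin := fun I : Finset (Fin n) => measurable_minimizer hS hf hg hs I
  have h1 : MeasurableSet {p : (Fin n → X) × X | S.f (S.minimizer g p.1 Finset.univ) p.2 ≤ 0} :=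
    measurableSet_le ((measurable_uncurry_f hS hf).comp
      (((hmin _).comp measurable_fst).prodMk measurable_snd)) measurable_const
  have h2 : ∀ i : Fin n, MeasurableSet {p : (Fin n → X) × X |
      S.minimizer g p.1 (Finset.univ.erase i) = S.minimizer g p.1 Finset.univ →
        lab (p.1 i) < lab p.2} := fun i => by
    have e1 : MeasurableSet {p : (Fin n → X) × X |
        S.minimizer g p.1 (Finset.univ.erase i) = S.minimizer g p.1 Finset.univ} :=
      measurableSet_eq_fun ((hmin _).comp measurable_fst) ((hmin _).comp measurable_fst)
    have e2 : MeasurableSet {p : (Fin n → X) × X | lab (p.1 i) < lab p.2} :=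
      measurableSet_lt (hlab.comp ((measurable_pi_apply i).comp measurable_fst))
        (hlab.comp measurable_snd)
    exact e1.imp e2
  have h3 : {p : (Fin n → X) × X | S.Accepts g lab p.1 p.2} =
      {p : (Fin n → X) × X | S.f (S.minimizer g p.1 Finset.univ) p.2 ≤ 0} ∩ ⋂ i : Fin n,
        {p : (Fin n → X) × X |
          S.minimizer g p.1 (Finset.univ.erase i) = S.minimizer g p.1 Finset.univ →
            lab (p.1 i) < lab p.2} := by
    ext p; simp [Accepts]
  rw [h3]
  exact h1.inter (MeasurableSet.iInter h2)

end Measurable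

/-! ### Random relaxation makes instances nondegenerate. -/

/-- The problem in which the scenario constraint `f(θ, q) ≤ 0` is relaxed to `f(θ, q) ≤ ρ u`. -/
def relax (S : ScenarioProblem n X) (ρ : ℝ) : ScenarioProblem n (X × ℝ) where
  c := S.c
  Θ := S.Θ
  f θ x := S.f θ x.1 - ρ * x.2

theorem IsConvex.relax (hS : S.IsConvex) (ρ : ℝ) : (S.relax ρ).IsConvex where
  convex := hS.convex
  compact := hS.compact
  convexOn x := by
    have := (hS.convexOn x.1).add_const (-(ρ * x.2))
    simpa only [ScenarioProblem.relax, sub_eq_add_neg, Pi.add_def] using this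

end ScenarioProblem

/-- A measurable set of samples which meets every line in a fixed label direction in at most one
point is null. -/
theorem measure_eq_zero_of_subsingleton_label {Q : Type*} [MeasurableSpace Q] {m : ℕ}
    (P : Measure Q) [IsProbabilityMeasure P] (U : Measure ℝ) [IsProbabilityMeasure U] [NullSingletonClass U]
    {A : Set (Fin m → Q × ℝ)} (hA : MeasurableSet A) (i : Fin m)
    (h : ∀ ω ω' : Fin m → Q × ℝ, ω ∈ A → ω' ∈ A → (∀ j ≠ i, ω' j = ω j) →
      (ω' i).1 = (ω i).1 → (ω' i).2 = (ω i).2) :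
    (Measure.pi fun _ : Fin m => P.prod U) A = 0 := by
  obtain _ | m := m
  · exact i.elim0
  have hmp := (measurePreserving_piFinSuccAbove (fun _ : Fin (m + 1) => P.prod U) i).symm
  set e := (MeasurableEquiv.piFinSuccAbove (fun _ : Fin (m + 1) => Q × ℝ) i).symm
  -- Fubini with everything but the label of scenario i frozen: each slice has at most one point,
  -- hence `U`-measure zero.
  rw [← hmp.measure_preimage hA.nullMeasurableSet, Measure.prod_apply_symm (e.measurable hA)]
  refine lintegral_eq_zero_of_ae_eq_zero (Filter.Eventually.of_forall fun y => ?_)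
  have hA' : MeasurableSet ((fun x => (x, y)) ⁻¹' (e ⁻¹' A)) :=
    (e.measurable hA).preimage measurable_prodMk_right
  refine (Measure.measure_prod_null hA').2 (Filter.Eventually.of_forall fun q => ?_)
  refine Set.Subsingleton.measure_zero (fun u hu u' hu' => ?_) U
  have hval : ∀ x, e (x, y) = Fin.insertNth i x y := fun x => rfl
  have := h _ _ hu hu' (fun j hj => by
    obtain ⟨k, rfl⟩ := Fin.exists_succAbove_eq hj
    rw [hval, hval, Fin.insertNth_apply_succAbove, Fin.insertNth_apply_succAbove])
    (by rw [hval, hval, Fin.insertNth_apply_same, Fin.insertNth_apply_same])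
  rw [hval, hval, Fin.insertNth_apply_same, Fin.insertNth_apply_same] at this
  exact this.symm

namespace ScenarioProblem

variable {n m : ℕ} {Q : Type*} [MeasurableSpace Q] {S : ScenarioProblem n Q}
  {g : EuclideanSpace ℝ (Fin n) → ℝ} (P : Measure Q) [IsProbabilityMeasure P]
  (U : Measure ℝ) [IsProbabilityMeasure U] [NullSingletonClass U]

theorem measurable_relax (hf : ∀ θ, Measurable (S.f θ)) (ρ : ℝ)
    (θ : EuclideanSpace ℝ (Fin n)) : Measurable ((S.relax ρ).f θ) :=
  ((hf θ).comp measurable_fst).sub (measurable_snd.const_mul ρ)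

/-- The randomly relaxed problem is nondegenerate almost surely. -/
theorem ae_nondegenerate (hS : S.IsConvex) (hf : ∀ θ, Measurable (S.f θ)) (hg : Continuous g)
    (hs : StrictConvexOn ℝ Set.univ g) {ρ : ℝ} (hρ : 0 < ρ)
    (hne : ∀ᵐ ω ∂(Measure.pi fun _ : Fin m => P.prod U),
      ((S.relax ρ).feasible ω Finset.univ).Nonempty) :
    ∀ᵐ ω ∂(Measure.pi fun _ : Fin m => P.prod U), (S.relax ρ).Nondegenerate g Prod.snd ω := by
  have hS' := hS.relax ρ
  have hf' := measurable_relax hf ρ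
  have hmin := fun I : Finset (Fin m) => measurable_minimizer hS' hf' hg hs I
  have h1 : ∀ᵐ ω ∂(Measure.pi fun _ : Fin m => P.prod U), ∀ i j : Fin m, i ≠ j →
      (ω i).2 ≠ (ω j).2 := by
    simp only [Filter.eventually_all]
    intro i j hij
    have h0 : (Measure.pi fun _ : Fin m => P.prod U) {ω | (ω i).2 = (ω j).2} = 0 := by
      refine measure_eq_zero_of_subsingleton_label P U (measurableSet_eq_fun
        (measurable_snd.comp (measurable_pi_apply i))
        (measurable_snd.comp (measurable_pi_apply j))) i ?_
      intro ω ω' hω hω' hoff _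
      have e1 : (ω i).2 = (ω j).2 := hω
      have e2 : (ω' i).2 = (ω' j).2 := hω'
      rw [e1, e2, hoff j hij.symm]
    filter_upwards [measure_eq_zero_iff_ae_notMem.1 h0] with ω hω using hω
  have h2 : ∀ᵐ ω ∂(Measure.pi fun _ : Fin m => P.prod U), ∀ (i : Fin m) (I J : Finset (Fin m)),
      i ∈ I → i ∉ J → ω ∉ {ω | ((S.relax ρ).feasible ω Finset.univ).Nonempty ∧
        (S.relax ρ).minimizer g ω (I.erase i) ≠ (S.relax ρ).minimizer g ω I ∧
        (S.relax ρ).minimizer g ω I = (S.relax ρ).minimizer g ω J} := by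
    simp only [Filter.eventually_all]
    intro i I J hi hiJ
    refine measure_eq_zero_iff_ae_notMem.1 (measure_eq_zero_of_subsingleton_label P U
      ((measurableSet_feasible_nonempty hS' hf' _).inter
        ((measurableSet_eq_fun (hmin _) (hmin _)).compl.inter
          (measurableSet_eq_fun (hmin _) (hmin _)))) i ?_)
    -- On a line in label direction i, a larger label strictly relaxes constraint i because ρ > 0,
    -- and `minimizer_ne_of_relax` then excludes a second coincidence.
    have key : ∀ ω ω' : Fin m → Q × ℝ,
        ((S.relax ρ).feasible ω Finset.univ).Nonempty ∧
        (S.relax ρ).minimizer g ω (I.erase i) ≠ (S.relax ρ).minimizer g ω I ∧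
        (S.relax ρ).minimizer g ω I = (S.relax ρ).minimizer g ω J →
        (S.relax ρ).minimizer g ω' I = (S.relax ρ).minimizer g ω' J →
        (∀ j ≠ i, ω' j = ω j) → (ω' i).1 = (ω i).1 → ¬ (ω i).2 < (ω' i).2 := by
      intro ω ω' hω hω' hoff h1 hlt
      refine minimizer_ne_of_relax hS' hg hs hoff (fun θ => ?_) hω.1 hi hiJ hω.2.1 hω.2.2 hω'
      simp only [ScenarioProblem.relax, h1]
      have := mul_lt_mul_of_pos_left hlt hρ
      linarith
    intro ω ω' hω hω' hoff h1
    exact le_antisymm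
      (not_lt.1 (key ω ω' hω hω'.2.2 hoff h1))
      (not_lt.1 (key ω' ω hω' hω.2.2 (fun j hj => (hoff j hj).symm) h1.symm))
  filter_upwards [hne, h1, h2] with ω hω1 hω2 hω3
  refine ⟨hω1, fun i j hij => ?_, fun i I J hi hiJ hne heq => hω3 i I J hi hiJ ⟨hω1, hne, heq⟩⟩
  by_contra hne
  exact hω2 i j hne hij

/-- For randomly relaxed problems, the violation of the solution is at most `ε` with probability at
least `binomTail n m ε`. -/
theorem binomTail_le_measure_relax (hS : S.IsConvex) (hf : ∀ θ, Measurable (S.f θ))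
    (hg : Continuous g) (hs : StrictConvexOn ℝ Set.univ g) {ρ : ℝ} (hρ : 0 < ρ)
    (hne : ∀ m : ℕ, ∀ᵐ ω ∂(Measure.pi fun _ : Fin m => P.prod U),
      ((S.relax ρ).feasible ω Finset.univ).Nonempty) (hm : n ≤ m) {ε : ℝ}
    (hε : ε ∈ Set.Icc (0 : ℝ) 1) :
    ENNReal.ofReal (binomTail n m ε) ≤ (Measure.pi fun _ : Fin m => P.prod U)
      {ω | (S.relax ρ).violation (P.prod U) ((S.relax ρ).minimizer g ω Finset.univ) ≤ ε} := by
  have hS' := hS.relax ρ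
  have hf' := measurable_relax hf ρ
  have hT := measurableSet_accepts hS' hf' hg hs measurable_snd
  have hnd := fun m => ae_nondegenerate P U hS hf hg hs hρ (hne m)
  have hU : ∀ m, ∀ᵐ ω ∂(Measure.pi fun _ : Fin m => P.prod U), ∀ s s' : Finset (Fin m),
      ∀ (hs : s.card = n) (hs' : s'.card = n),
      IsCompression ((S.relax ρ).Accepts g Prod.snd) s hs ω →
      IsCompression ((S.relax ρ).Accepts g Prod.snd) s' hs' ω → s = s' := fun m => by
    filter_upwards [hnd m] with ω hω s s' h h' h1 h2
    exact hω.isCompression_unique hS' hg hs h1 h2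
  have hmap := map_rejection_eq_maxUniformLaw (P.prod U) hT (fun m hm => by
    filter_upwards [hnd m] with ω hω using hω.exists_isCompression hS' hg hs hm) hU
  rw [← measure_exists_isCompression_le (P.prod U) hT hmap hm (hU m) hε]
  refine measure_mono_ae ?_
  filter_upwards [hnd m] with ω hω
  rintro ⟨s, hcard, hcomp, hle⟩
  -- Only an inequality: a violated constraint is rejected, but rejection can also come from a low
  -- label.
  refine le_trans ?_ hle
  refine measureReal_mono fun x hx hacc => ?_
  have h1 := hacc.1
  rw [minimizer, feasible_subTuple_univ] at h1
  rw [← minimizer_eq_of_isCompression hS' hg hs hω.nonempty hcomp] at hx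
  exact absurd h1 (not_le.2 hx)

end ScenarioProblem

end

/-! ### Removing the perturbations by passage to the limit. -/

noncomputable section

section Limits

open Filter

variable {Ω : Type*} [MeasurableSpace Ω] {μ : Measure Ω} {A : Set Ω} {B : ℕ → Set Ω} {c : ℝ≥0∞}

/-- Fatou's lemma for sets: the tail intersections `D k` increase to a set that contains almost all
of A. -/
theorem eventually_lt_measure (h : ∀ᵐ ω ∂μ, ω ∈ A → ∀ᶠ k in atTop, ω ∈ B k) (hc : c < μ A) :
    ∀ᶠ k in atTop, c < μ (B k) := by
  let D : ℕ → Set Ω := fun k => ⋂ j ≥ k, B j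
  have hD : Monotone D := fun a b hab =>
    Set.biInter_subset_biInter_left fun j (hj : b ≤ j) => hab.trans hj
  have h1 : μ A ≤ μ (⋃ k, D k) := by
    refine measure_mono_ae ?_
    filter_upwards [h] with ω hω hA
    obtain ⟨K, hK⟩ := eventually_atTop.1 (hω hA)
    exact Set.mem_iUnion.2 ⟨K, Set.mem_iInter₂.2 hK⟩
  rw [hD.measure_iUnion] at h1
  obtain ⟨K, hK⟩ := lt_iSup_iff.1 (hc.trans_le h1)
  exact eventually_atTop.2 ⟨K, fun k hk => hK.trans_le
    (measure_mono (Set.biInter_subset_of_mem (show k ∈ {j | j ≥ K} from hk)))⟩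

theorem measure_le_of_eventually_mem (h : ∀ᵐ ω ∂μ, ω ∈ A → ∀ᶠ k in atTop, ω ∈ B k)
    (hc : ∀ k, μ (B k) ≤ c) : μ A ≤ c := by
  by_contra hlt
  obtain ⟨k, hk⟩ := (eventually_lt_measure h (not_le.1 hlt)).exists
  exact absurd hk (not_lt.2 (hc k))

theorem eventually_lt_measureReal {Ω' : Type*} [MeasurableSpace Ω'] {ν : Measure Ω'}
    [IsProbabilityMeasure μ] [IsProbabilityMeasure ν] {A' : Set Ω'} {e : ℝ}
    (h : ∀ᵐ ω ∂μ, ω ∈ A → ∀ᶠ k in atTop, ω ∈ B k) (hA : ν A' = μ A) (he : e < ν.real A') :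
    ∀ᶠ k in atTop, e < μ.real (B k) := by
  rcases lt_or_ge e 0 with h0 | h0
  · exact Eventually.of_forall fun k => h0.trans_le measureReal_nonneg
  · rw [measureReal_def, hA, ← ENNReal.ofReal_lt_iff_lt_toReal h0 (measure_ne_top _ _)] at he
    filter_upwards [eventually_lt_measure h he] with k hk
    rwa [measureReal_def, ← ENNReal.ofReal_lt_iff_lt_toReal h0 (measure_ne_top _ _)]

theorem IsCompact.tendsto_of_subseq {E : Type*} [TopologicalSpace E] [FirstCountableTopology E]
    {K : Set E} (hK : IsCompact K) {x : ℕ → E} {y : E} (hx : ∀ k, x k ∈ K)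
    (h : ∀ (ψ : ℕ → ℕ) (z : E), StrictMono ψ → Tendsto (x ∘ ψ) atTop (nhds z) → z = y) :
    Tendsto x atTop (nhds y) :=
  hK.tendsto_nhds_of_unique_mapClusterPt (Eventually.of_forall hx) fun z _ hz => by
    obtain ⟨ψ, hψ, hz'⟩ := hz.tendsto_subseq
    exact h ψ z hψ hz'

end Limits

namespace ScenarioProblem

open Filter

variable {n m : ℕ} {Q : Type*} {S : ScenarioProblem n Q} {ω : Fin m → Q} {I : Finset (Fin m)}

theorem continuous_cost (S : ScenarioProblem n Q) : Continuous S.cost := by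
  unfold cost
  fun_prop

theorem convexOn_cost (S : ScenarioProblem n Q) : ConvexOn ℝ Set.univ S.cost :=
  (innerSL ℝ S.c).toLinearMap.convexOn convex_univ

theorem strictConvexOn_normSq :
    StrictConvexOn ℝ Set.univ fun θ : EuclideanSpace ℝ (Fin n) => ‖θ‖ ^ 2 := by
  refine StrongConvexOn.strictConvexOn (m := 2) ?_ two_pos
  rw [strongConvexOn_iff_convex]
  simpa using convexOn_const (0 : ℝ) convex_univ

/-- The strictly convex objective `cᵀθ + δ ‖θ‖²`. -/
def regularizedCost (S : ScenarioProblem n Q) (δ : ℝ) (θ : EuclideanSpace ℝ (Fin n)) : ℝ :=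
  S.cost θ + δ * ‖θ‖ ^ 2

theorem continuous_regularizedCost (S : ScenarioProblem n Q) (δ : ℝ) :
    Continuous (S.regularizedCost δ) := by
  have := S.continuous_cost
  unfold regularizedCost
  fun_prop

theorem strictConvexOn_regularizedCost (S : ScenarioProblem n Q) {δ : ℝ} (hδ : 0 < δ) :
    StrictConvexOn ℝ Set.univ (S.regularizedCost δ) := by
  refine StrongConvexOn.strictConvexOn (m := 2 * δ) ?_ (by positivity)
  rw [strongConvexOn_iff_convex]
  refine S.convexOn_cost.congr fun θ _ => ?_
  simp [regularizedCost]

/-- The optimal solutions of the problem with the constraints in `I`. -/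
def optimalSet (S : ScenarioProblem n Q) (ω : Fin m → Q) (I : Finset (Fin m)) :
    Set (EuclideanSpace ℝ (Fin n)) :=
  {θ | θ ∈ S.feasible ω I ∧ ∀ θ' ∈ S.feasible ω I, S.cost θ ≤ S.cost θ'}

/-- The optimal solution of minimal norm. -/
def leastNormOptimum (S : ScenarioProblem n Q) (ω : Fin m → Q) (I : Finset (Fin m)) :
    EuclideanSpace ℝ (Fin n) :=
  argminOn (fun θ => ‖θ‖ ^ 2) (S.optimalSet ω I)

theorem optimalSet_eq {θ : EuclideanSpace ℝ (Fin n)} (hθ : θ ∈ S.optimalSet ω I) :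
    S.optimalSet ω I = S.feasible ω I ∩ {θ' | S.cost θ' ≤ S.cost θ} := by
  ext θ'
  exact ⟨fun h => ⟨h.1, h.2 _ hθ.1⟩, fun h => ⟨h.1, fun x hx => le_trans h.2 (hθ.2 x hx)⟩⟩

section Optimal

variable (hS : S.IsConvex)
include hS

theorem optimalSet_nonempty (hne : (S.feasible ω I).Nonempty) : (S.optimalSet ω I).Nonempty :=
  hS.isCompact_feasible.exists_isMinOn hne S.continuous_cost.continuousOn

theorem isCompact_optimalSet : IsCompact (S.optimalSet ω I) := by
  rcases (S.optimalSet ω I).eq_empty_or_nonempty with h | ⟨θ, hθ⟩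
  · rw [h]; exact isCompact_empty
  · rw [optimalSet_eq hθ]
    exact hS.isCompact_feasible.inter_right (isClosed_le S.continuous_cost continuous_const)

theorem convex_optimalSet : Convex ℝ (S.optimalSet ω I) := by
  rcases (S.optimalSet ω I).eq_empty_or_nonempty with h | ⟨θ, hθ⟩
  · rw [h]; exact convex_empty
  · rw [optimalSet_eq hθ]
    exact hS.convex_feasible.inter (by simpa using S.convexOn_cost.convex_le (S.cost θ))

theorem leastNormOptimum_spec (hne : (S.feasible ω I).Nonempty) :
    S.leastNormOptimum ω I ∈ S.optimalSet ω I ∧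
      ∀ θ ∈ S.optimalSet ω I, ‖S.leastNormOptimum ω I‖ ^ 2 ≤ ‖θ‖ ^ 2 :=
  argminOn_spec (by fun_prop) (isCompact_optimalSet hS) (optimalSet_nonempty hS hne)

theorem eq_leastNormOptimum {θ : EuclideanSpace ℝ (Fin n)} (hθ : θ ∈ S.optimalSet ω I)
    (hle : ‖θ‖ ^ 2 ≤ ‖S.leastNormOptimum ω I‖ ^ 2) : θ = S.leastNormOptimum ω I :=
  eq_argminOn (g := fun θ : EuclideanSpace ℝ (Fin n) => ‖θ‖ ^ 2) (by fun_prop)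
    strictConvexOn_normSq (isCompact_optimalSet hS) (convex_optimalSet hS) hθ hle

theorem mem_feasible_of_tendsto {x : ℕ → EuclideanSpace ℝ (Fin n)}
    {z : EuclideanSpace ℝ (Fin n)} (hx : Tendsto x atTop (nhds z)) {r : ℕ → Fin m → ℝ}
    (hr : ∀ i, Tendsto (fun k => r k i) atTop (nhds 0)) (hΘ : ∀ k, x k ∈ S.Θ)
    (h : ∀ k, ∀ i ∈ I, S.f (x k) (ω i) ≤ r k i) : z ∈ S.feasible ω I := by
  refine ⟨hS.compact.isClosed.mem_of_tendsto hx (Eventually.of_forall hΘ), fun i hi => ?_⟩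
  exact le_of_tendsto_of_tendsto' (((hS.continuous (ω i)).tendsto z).comp hx) (hr i)
    fun k => h k i hi

/-- Every subsequential limit has optimal cost because the penalty vanishes, and among the optima it
has least norm; compactness does the rest. -/
theorem tendsto_minimizer_regularizedCost {δ : ℕ → ℝ} (hδ : ∀ k, 0 < δ k)
    (hδ0 : Tendsto δ atTop (nhds 0)) (ω : Fin m → Q) (I : Finset (Fin m)) :
    Tendsto (fun k => S.minimizer (S.regularizedCost (δ k)) ω I) atTop
      (nhds (S.leastNormOptimum ω I)) := by
  by_cases hne : (S.feasible ω I).Nonempty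
  · obtain ⟨hopt, hmin⟩ := leastNormOptimum_spec hS hne
    set θ₀ := S.leastNormOptimum ω I with hθ₀
    have hmem := fun k => minimizer_mem hS (S.continuous_regularizedCost (δ k)) hne
    have hle := fun k => minimizer_le hS (S.continuous_regularizedCost (δ k)) hopt.1
    refine hS.isCompact_feasible.tendsto_of_subseq hmem fun ψ z hψ hz => ?_
    have hzf : z ∈ S.feasible ω I := hS.isCompact_feasible.isClosed.mem_of_tendsto hz
      (Eventually.of_forall fun k => hmem _)
    have hcost : S.cost z ≤ S.cost θ₀ := by
      have h1 : Tendsto (fun k => S.cost θ₀ + δ (ψ k) * ‖θ₀‖ ^ 2) atTop (nhds (S.cost θ₀)) := by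
        have := (hδ0.comp hψ.tendsto_atTop).mul_const (‖θ₀‖ ^ 2)
        simpa using this.const_add (S.cost θ₀)
      refine le_of_tendsto_of_tendsto' ((S.continuous_cost.tendsto z).comp hz) h1 fun k => ?_
      have h2 := hle (ψ k)
      have h3 : 0 ≤ δ (ψ k) * ‖S.minimizer (S.regularizedCost (δ (ψ k))) ω I‖ ^ 2 :=
        mul_nonneg (hδ _).le (by positivity)
      simp only [regularizedCost] at h2 h3
      simp only [Function.comp]
      linarith
    -- Since θ₀ has least cost, comparing the regularised values leaves δ‖x‖² ≤ δ‖θ₀‖², where δ > 0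
    -- cancels.
    have hnorm : ‖z‖ ^ 2 ≤ ‖θ₀‖ ^ 2 := by
      have hc : Continuous fun θ : EuclideanSpace ℝ (Fin n) => ‖θ‖ ^ 2 := by fun_prop
      refine le_of_tendsto' ((hc.tendsto z).comp hz) fun k => ?_
      have h2 := hle (ψ k)
      have h3 := hopt.2 _ (hmem (ψ k))
      simp only [regularizedCost] at h2 h3
      simp only [Function.comp]
      exact le_of_mul_le_mul_left (by linarith) (hδ (ψ k))
    exact eq_leastNormOptimum hS ⟨hzf, fun θ hθ => hcost.trans (hopt.2 θ hθ)⟩ hnorm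
  · have he := Set.not_nonempty_iff_eq_empty.1 hne
    have h1 : S.leastNormOptimum ω I = 0 := by
      rw [leastNormOptimum, optimalSet, he]
      simp [argminOn]
    simp only [minimizer, he, argminOn_empty, h1]
    exact tendsto_const_nhds

/-- Nonnegative labels only enlarge the feasible set, so relaxed minimal values stay below the
original one, while limits of relaxed minimisers are feasible for the original problem. -/
theorem tendsto_minimizer_relax {g : EuclideanSpace ℝ (Fin n) → ℝ} (hg : Continuous g)
    (hs : StrictConvexOn ℝ Set.univ g) {ρ : ℕ → ℝ} (hρ : ∀ k, 0 < ρ k)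
    (hρ0 : Tendsto ρ atTop (nhds 0)) {ω : Fin m → Q × ℝ} (hu : ∀ i, 0 ≤ (ω i).2)
    (hne : (S.feasible (fun i => (ω i).1) I).Nonempty) :
    Tendsto (fun k => (S.relax (ρ k)).minimizer g ω I) atTop
      (nhds (S.minimizer g (fun i => (ω i).1) I)) := by
  have hmem := minimizer_mem hS hg hne
  have hsub : ∀ k, S.feasible (fun i => (ω i).1) I ⊆ (S.relax (ρ k)).feasible ω I := by
    refine fun k θ hθ => ⟨hθ.1, fun i hi => ?_⟩
    have := mul_nonneg (hρ k).le (hu i)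
    have := hθ.2 i hi
    simp only [ScenarioProblem.relax]
    linarith
  have hmem' := fun k => minimizer_mem (hS.relax (ρ k)) hg (hne.mono (hsub k))
  have hle := fun k => minimizer_le (hS.relax (ρ k)) hg (hsub k hmem)
  refine hS.compact.tendsto_of_subseq (fun k => (hmem' k).1) fun ψ z hψ hz => ?_
  refine eq_minimizer hS hg hs (mem_feasible_of_tendsto hS hz (r := fun k i => ρ (ψ k) * (ω i).2)
    (fun i => ?_) (fun k => (hmem' _).1) fun k i hi => ?_) ?_
  · simpa using (hρ0.comp hψ.tendsto_atTop).mul_const (ω i).2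
  · exact sub_nonpos.1 ((hmem' (ψ k)).2 i hi)
  · exact le_of_tendsto' ((hg.tendsto z).comp hz) fun k => hle (ψ k)

end Optimal

variable [MeasurableSpace Q] (P : Measure Q) [IsProbabilityMeasure P]
  (hS : S.IsConvex) (hf : ∀ θ, Measurable (S.f θ))
include hS

/-- Lower semicontinuity of V: a strict violation f(z, q) > 0 persists near z. -/
theorem eventually_lt_violation {x : ℕ → EuclideanSpace ℝ (Fin n)}
    {z : EuclideanSpace ℝ (Fin n)} (hx : Tendsto x atTop (nhds z)) {ε : ℝ}
    (h : ε < S.violation P z) : ∀ᶠ k in atTop, ε < S.violation P (x k) := by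
  refine eventually_lt_measureReal (Eventually.of_forall fun q hq => ?_) rfl h
  exact (((hS.continuous q).tendsto z).comp hx).eventually_const_lt hq

include hf

theorem measurable_leastNormOptimum (I : Finset (Fin m)) :
    Measurable fun ω : Fin m → Q => S.leastNormOptimum ω I := by
  refine measurable_of_tendsto_metrizable (f := fun (k : ℕ) ω =>
    S.minimizer (S.regularizedCost (1 / ((k : ℝ) + 1))) ω I) (fun k => ?_) ?_
  · exact measurable_minimizer hS hf (S.continuous_regularizedCost _)
      (S.strictConvexOn_regularizedCost Nat.one_div_pos_of_nat) I
  · rw [tendsto_pi_nhds]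
    exact fun ω => tendsto_minimizer_regularizedCost hS (fun k => Nat.one_div_pos_of_nat)
      tendsto_one_div_add_atTop_nhds_zero_nat ω I

theorem measurable_violation : Measurable (S.violation P) := by
  have h : MeasurableSet {p : EuclideanSpace ℝ (Fin n) × Q | 0 < S.f p.1 p.2} :=
    measurableSet_lt measurable_const (measurable_uncurry_f hS hf)
  exact (measurable_measure_prodMk_left (ν := P) h).ennreal_toReal

theorem eventually_lt_violation_relax (U : Measure ℝ) [IsProbabilityMeasure U] {ρ : ℕ → ℝ}
    (hρ0 : Tendsto ρ atTop (nhds 0)) {x : ℕ → EuclideanSpace ℝ (Fin n)}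
    {z : EuclideanSpace ℝ (Fin n)} (hx : Tendsto x atTop (nhds z)) {ε : ℝ}
    (h : ε < S.violation P z) :
    ∀ᶠ k in atTop, ε < (S.relax (ρ k)).violation (P.prod U) (x k) := by
  refine eventually_lt_measureReal (μ := P.prod U) (ν := P) (A := {p | 0 < S.f z p.1})
    (A' := {q | 0 < S.f z q}) (Eventually.of_forall fun p hp => ?_) ?_ h
  · have h1 : Tendsto (fun k => S.f (x k) p.1 - ρ k * p.2) atTop (nhds (S.f z p.1)) := by
      have := (((hS.continuous p.1).tendsto z).comp hx).sub (hρ0.mul_const p.2)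
      simpa using this
    exact h1.eventually_const_lt hp
  · have hm : MeasurableSet {q | 0 < S.f z q} := measurableSet_lt measurable_const (hf z)
    exact (measurePreserving_fst.measure_preimage hm.nullMeasurableSet).symm

theorem ae_feasible_nonempty_of_le {k : ℕ} (hkm : k ≤ m)
    (h : ∀ᵐ ω ∂(Measure.pi fun _ : Fin m => P), (S.feasible ω Finset.univ).Nonempty) :
    ∀ᵐ ω ∂(Measure.pi fun _ : Fin k => P), (S.feasible ω Finset.univ).Nonempty := by
  obtain ⟨s, -, hs⟩ := Finset.exists_subset_card_eq (s := (Finset.univ : Finset (Fin m)))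
    (n := k) (by simpa using hkm)
  have hmp := measurePreserving_subTuple P s hs
  rw [← hmp.map_eq, ae_map_iff hmp.aemeasurable (measurableSet_feasible_nonempty hS hf _)]
  filter_upwards [h] with ω hω
  rw [feasible_subTuple_univ]
  exact feasible_nonempty_of_univ hω

/-- Almost sure feasibility for more than `n` scenarios implies almost sure feasibility for any
number of scenarios. -/
theorem ae_feasible_nonempty {M : ℕ} (hM : n + 1 ≤ M)
    (h : ∀ᵐ ω ∂(Measure.pi fun _ : Fin M => P), (S.feasible ω Finset.univ).Nonempty) (m : ℕ) :
    ∀ᵐ ω ∂(Measure.pi fun _ : Fin m => P), (S.feasible ω Finset.univ).Nonempty := by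
  have h0 := ae_feasible_nonempty_of_le P hS hf hM h
  rcases le_total m (n + 1) with hm | hm
  · exact ae_feasible_nonempty_of_le P hS hf hm h0
  · have h1 : ∀ᵐ ω ∂(Measure.pi fun _ : Fin m => P), ∀ s : {s : Finset (Fin m) // s.card = n + 1},
        (S.feasible (subTuple s.1 s.2 ω) Finset.univ).Nonempty :=
      eventually_countable_forall.2 fun s =>
        (measurePreserving_subTuple P s.1 s.2).quasiMeasurePreserving.ae h0
    filter_upwards [h1] with ω hω
    refine hS.feasible_nonempty hm fun s hs => ?_
    rw [← feasible_subTuple_univ s hs]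
    exact hω ⟨s, hs⟩

variable (hne : ∀ m : ℕ, ∀ᵐ ω ∂(Measure.pi fun _ : Fin m => P),
  (S.feasible ω Finset.univ).Nonempty)
include hne

/-- Attach uniform labels to the scenarios, which does not change the law of the original data, and
let ρ = 1/(k+1) tend to 0. The event V > ε is used because strict inequalities survive the limit. -/
theorem measure_lt_violation_minimizer_le {g : EuclideanSpace ℝ (Fin n) → ℝ} (hg : Continuous g)
    (hs : StrictConvexOn ℝ Set.univ g) (hm : n ≤ m) {ε : ℝ} (hε : ε ∈ Set.Icc (0 : ℝ) 1) :
    (Measure.pi fun _ : Fin m => P) {ω | ε < S.violation P (S.minimizer g ω Finset.univ)}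
      ≤ 1 - ENNReal.ofReal (binomTail n m ε) := by
  let U : Measure ℝ := volume.restrict (Set.Icc 0 1)
  have : IsProbabilityMeasure U := ⟨by simp [U]⟩
  have hmpU : MeasurePreserving (Prod.fst : Q × ℝ → Q) (P.prod U) P := measurePreserving_fst
  have hmp : ∀ m : ℕ, MeasurePreserving (fun (ω : Fin m → Q × ℝ) i => (ω i).1)
      (Measure.pi fun _ => P.prod U) (Measure.pi fun _ => P) := fun m =>
    measurePreserving_pi (fun _ => P.prod U) (fun _ => P) fun _ => hmpU
  have hu : ∀ m : ℕ, ∀ᵐ ω ∂(Measure.pi fun _ : Fin m => P.prod U), ∀ i, 0 ≤ (ω i).2 := fun m => by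
    refine eventually_countable_forall.2 fun i => ?_
    have h1 : ∀ᵐ u ∂U, (0 : ℝ) ≤ u := by
      filter_upwards [ae_restrict_mem measurableSet_Icc] with u hu using hu.1
    have h2 : ∀ᵐ p ∂(P.prod U), 0 ≤ p.2 :=
      (measurePreserving_snd (μ := P) (ν := U)).quasiMeasurePreserving.ae h1
    exact (measurePreserving_eval (fun _ : Fin m => P.prod U) i).quasiMeasurePreserving.ae h2
  have hneU : ∀ m : ℕ, ∀ᵐ ω ∂(Measure.pi fun _ : Fin m => P.prod U),
      (S.feasible (fun i => (ω i).1) Finset.univ).Nonempty := fun m =>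
    (hmp m).quasiMeasurePreserving.ae (hne m)
  have hmeas := (measurable_violation P hS hf).comp
    (measurable_minimizer hS hf hg hs (m := m) Finset.univ)
  have hset : MeasurableSet {ω : Fin m → Q | ε < S.violation P (S.minimizer g ω Finset.univ)} :=
    measurableSet_lt measurable_const hmeas
  rw [← (hmp m).measure_preimage hset.nullMeasurableSet]
  let ρ : ℕ → ℝ := fun k => 1 / ((k : ℝ) + 1)
  have hρ : ∀ k, 0 < ρ k := fun k => Nat.one_div_pos_of_nat
  have hρ0 : Tendsto ρ atTop (nhds 0) := tendsto_one_div_add_atTop_nhds_zero_nat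
  refine measure_le_of_eventually_mem (B := fun k => {ω |
    ε < (S.relax (ρ k)).violation (P.prod U) ((S.relax (ρ k)).minimizer g ω Finset.univ)}) ?_
    fun k => ?_
  · filter_upwards [hu m, hneU m] with ω hω1 hω2 hω
    exact eventually_lt_violation_relax P hS hf U hρ0
      (tendsto_minimizer_relax hS hg hs hρ hρ0 hω1 hω2) hω
  · have hle := binomTail_le_measure_relax P U hS hf hg hs (hρ k) (m := m) (fun m => by
      filter_upwards [hu m, hneU m] with ω hω1 hω2
      refine hω2.mono fun θ hθ => ⟨hθ.1, fun i hi => ?_⟩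
      have := mul_nonneg (hρ k).le (hω1 i)
      have := hθ.2 i hi
      simp only [ScenarioProblem.relax]
      linarith) hm hε
    have hmk : MeasurableSet {ω : Fin m → Q × ℝ |
        (S.relax (ρ k)).violation (P.prod U) ((S.relax (ρ k)).minimizer g ω Finset.univ) ≤ ε} :=
      measurableSet_le ((measurable_violation (P.prod U) (hS.relax _) (measurable_relax hf _)).comp
        (measurable_minimizer (hS.relax _) (measurable_relax hf _) hg hs Finset.univ))
        measurable_const
    have hcompl : {ω : Fin m → Q × ℝ | ε <
        (S.relax (ρ k)).violation (P.prod U) ((S.relax (ρ k)).minimizer g ω Finset.univ)} =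
        {ω : Fin m → Q × ℝ | (S.relax (ρ k)).violation (P.prod U)
          ((S.relax (ρ k)).minimizer g ω Finset.univ) ≤ ε}ᶜ := by
      ext ω; simp
    rw [hcompl, prob_compl_eq_one_sub hmk]
    exact tsub_le_tsub_left hle 1

theorem measure_lt_violation_leastNormOptimum_le (hm : n ≤ m) {ε : ℝ}
    (hε : ε ∈ Set.Icc (0 : ℝ) 1) :
    (Measure.pi fun _ : Fin m => P) {ω | ε < S.violation P (S.leastNormOptimum ω Finset.univ)}
      ≤ 1 - ENNReal.ofReal (binomTail n m ε) := by
  refine measure_le_of_eventually_mem (B := fun k : ℕ => {ω | ε < S.violation P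
    (S.minimizer (S.regularizedCost (1 / ((k : ℝ) + 1))) ω Finset.univ)})
    (Eventually.of_forall fun ω hω => ?_) fun k => ?_
  · exact eventually_lt_violation P hS
      (tendsto_minimizer_regularizedCost hS (fun k => Nat.one_div_pos_of_nat)
      tendsto_one_div_add_atTop_nhds_zero_nat ω Finset.univ) hω
  · exact measure_lt_violation_minimizer_le P hS hf hne (S.continuous_regularizedCost _)
      (S.strictConvexOn_regularizedCost Nat.one_div_pos_of_nat) hm hε

theorem binomTail_le_measure_leastNormOptimum (hm : n ≤ m) {ε : ℝ}
    (hε : ε ∈ Set.Icc (0 : ℝ) 1) :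
    ENNReal.ofReal (binomTail n m ε) ≤ (Measure.pi fun _ : Fin m => P)
      {ω | S.violation P (S.leastNormOptimum ω Finset.univ) ≤ ε} := by
  have h := measure_lt_violation_leastNormOptimum_le P hS hf hne hm hε
  have hset : MeasurableSet {ω : Fin m → Q |
      S.violation P (S.leastNormOptimum ω Finset.univ) ≤ ε} :=
    measurableSet_le ((measurable_violation P hS hf).comp
      (measurable_leastNormOptimum hS hf Finset.univ)) measurable_const
  have hcompl : {ω : Fin m → Q | ε < S.violation P (S.leastNormOptimum ω Finset.univ)} =
      {ω : Fin m → Q | S.violation P (S.leastNormOptimum ω Finset.univ) ≤ ε}ᶜ := by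
    ext ω; simp
  rw [hcompl, prob_compl_eq_one_sub hset] at h
  have h1 : ENNReal.ofReal (binomTail n m ε) ≤ 1 := by
    rw [← ENNReal.ofReal_one]
    exact ENNReal.ofReal_le_ofReal (binomTail_le_one n m hε)
  exact (ENNReal.sub_le_sub_iff_left h1 ENNReal.one_ne_top).1 h

end ScenarioProblem

end

/-! ### Fully supported problems: equality. -/

noncomputable section

/-- A law on `[0, 1]` that is stochastically dominated by `maxUniformLaw n` and shares one positive
moment of `1 - a` with it is equal to it. -/
theorem eq_maxUniformLaw_of_le {n k : ℕ} (hk : k ≠ 0) {F : Measure ℝ} [IsProbabilityMeasure F]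
    (hF : F (Set.Icc 0 1)ᶜ = 0)
    (hle : ∀ x ∈ Set.Icc (0 : ℝ) 1, ENNReal.ofReal (x ^ n) ≤ F (Set.Iic x))
    (hmom : ∫⁻ a, ENNReal.ofReal (1 - a) ^ k ∂F
      = ∫⁻ a, ENNReal.ofReal (1 - a) ^ k ∂(maxUniformLaw n)) : F = maxUniformLaw n := by
  set B := maxUniformLaw n with hB
  have hnull : ∀ (ξ : Measure ℝ), ξ (Set.Icc 0 1)ᶜ = 0 → ∀ x < 0, ξ (Set.Iic x) = 0 := by
    intro ξ hξ x hx
    have hsub : Set.Iic x ⊆ (Set.Icc (0 : ℝ) 1)ᶜ := fun a ha h =>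
      absurd (h.1.trans ha) (not_le.2 hx)
    exact measure_mono_null hsub hξ
  have hfull : ∀ (ξ : Measure ℝ) [IsProbabilityMeasure ξ], ξ (Set.Icc 0 1)ᶜ = 0 → ∀ x, 1 ≤ x →
      ξ (Set.Iic x) = 1 := by
    intro ξ _ hξ x hx
    rw [← measure_univ (μ := ξ)]
    refine measure_congr (Filter.eventuallyEq_univ.2 ?_)
    have : ∀ᵐ a ∂ξ, a ∈ Set.Icc (0 : ℝ) 1 := hξ
    filter_upwards [this] with a ha using ha.2.trans hx
  have hBc := maxUniformLaw_compl n
  have hIic : ∀ x, B (Set.Iic x) ≤ F (Set.Iic x) := by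
    intro x
    rcases lt_or_ge x 0 with h0 | h0
    · rw [hnull B hBc x h0]; exact zero_le
    rcases le_or_gt x 1 with h1 | h1
    · rw [hB, maxUniformLaw_Iic n ⟨h0, h1⟩]; exact hle x ⟨h0, h1⟩
    · rw [hfull F hF x h1.le]; exact prob_le_one
  -- The truncation makes f nonnegative and antitone on the whole line, so its superlevel sets at t
  -- > 0 are half-lines on which distribution functions can be compared.
  let f : ℝ → ℝ := fun a => max (1 - a) 0 ^ k
  have hf0 : ∀ a, 0 ≤ f a := fun a => pow_nonneg (le_max_right _ _) _
  have hfm : Measurable f := by fun_prop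
  have hfa : Antitone f := fun a b hab =>
    pow_le_pow_left₀ (le_max_right _ _) (max_le_max (by linarith) le_rfl) k
  have hcake : ∀ ξ : Measure ℝ, ∫⁻ a, ENNReal.ofReal (1 - a) ^ k ∂ξ =
      ∫⁻ t in Set.Ioi 0, ξ {a | t ≤ f a} := by
    intro ξ
    rw [← lintegral_eq_lintegral_meas_le ξ (Filter.Eventually.of_forall hf0) hfm.aemeasurable]
    refine lintegral_congr fun a => ?_
    rw [ENNReal.ofReal_pow (le_max_right _ _), ENNReal.ofReal_max, ENNReal.ofReal_zero,
      max_eq_left zero_le]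
  rw [hcake, hcake] at hmom
  have hle' : ∀ t ∈ Set.Ioi (0 : ℝ), B {a | t ≤ f a} ≤ F {a | t ≤ f a} := by
    intro t ht
    have ht0 : (0 : ℝ) < t := ht
    have hr : (t ^ ((k : ℝ)⁻¹)) ^ k = t := Real.rpow_inv_natCast_pow ht0.le hk
    have hr0 : 0 < t ^ ((k : ℝ)⁻¹) := Real.rpow_pos_of_pos ht0 _
    have : {a | t ≤ f a} = Set.Iic (1 - t ^ ((k : ℝ)⁻¹)) := by
      ext a
      simp only [Set.mem_ofPred_eq, Set.mem_Iic, f]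
      nth_rewrite 1 [← hr]
      rw [pow_le_pow_iff_left₀ hr0.le (le_max_right _ _) hk, le_max_iff]
      constructor
      · rintro (h | h) <;> linarith
      · intro h; left; linarith
    rw [this]
    exact hIic _
  have hfin : ∫⁻ t in Set.Ioi 0, B {a | t ≤ f a} ≠ ∞ := by
    rw [← hcake]
    intro htop
    have h := choose_mul_lintegral_maxUniformLaw (show n ≤ n + k by omega)
    rw [Nat.add_sub_cancel_left, htop, ENNReal.mul_top (by
      exact_mod_cast (Nat.choose_pos (by omega)).ne')] at h
    exact ENNReal.top_ne_one h
  have hgm : AEMeasurable (fun t => F {a | t ≤ f a}) (volume.restrict (Set.Ioi (0 : ℝ))) := by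
    have : Antitone fun t => F {a | t ≤ f a} := fun s t hst =>
      measure_mono fun a (ha : t ≤ f a) => hst.trans ha
    exact this.measurable.aemeasurable
  -- In the layer-cake formula one integrand dominates the other while the finite integrals agree,
  -- so the two agree for almost every level t.
  have hae := ae_eq_of_ae_le_of_lintegral_le
    ((ae_restrict_iff' measurableSet_Ioi).2 (Filter.Eventually.of_forall hle')) hfin hgm hmom.le
  rw [Filter.EventuallyEq, ae_restrict_iff' measurableSet_Ioi] at hae
  refine Measure.ext_of_Iic _ _ fun x => le_antisymm ?_ (hIic x)
  rcases lt_or_ge x 0 with h0 | h0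
  · rw [hnull F hF x h0]; exact zero_le
  rcases le_or_gt 1 x with h1 | h1
  · rw [hB, hfull _ hBc x h1]; exact prob_le_one
  by_contra hlt
  rw [not_le, hB, maxUniformLaw_Iic n ⟨h0, h1.le⟩] at hlt
  have hcont : Filter.Tendsto (fun y : ℝ => ENNReal.ofReal (y ^ n)) (nhds x)
      (nhds (ENNReal.ofReal (x ^ n))) :=
    (ENNReal.continuous_ofReal.comp (continuous_pow n)).tendsto x
  have hev : ∀ᶠ y in nhdsWithin x (Set.Ioi x), ENNReal.ofReal (y ^ n) < F (Set.Iic x) :=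
    (hcont.eventually_lt_const hlt).filter_mono nhdsWithin_le_nhds
  have hev1 : ∀ᶠ y in nhdsWithin x (Set.Ioi x), y ∈ Set.Ioo x 1 := Ioo_mem_nhdsGT h1
  obtain ⟨y, hy, hxy, hy1⟩ := (hev.and hev1).exists
  -- For t between these powers the superlevel set contains `Iic x` and lies in `Iic y`, so F gives
  -- it more mass than B does; that contradicts agreement at almost every t.
  have hIoo : (1 - y) ^ k < (1 - x) ^ k := pow_lt_pow_left₀ (by linarith) (by linarith) hk
  have hvol : volume (Set.Ioo ((1 - y) ^ k) ((1 - x) ^ k)) ≠ 0 := by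
    simpa using hIoo
  refine hvol (measure_mono_null ?_ hae)
  intro t ht
  simp only [Set.mem_compl_iff, Set.mem_ofPred_eq]
  intro h
  have ht0 : 0 < t := lt_of_le_of_lt (pow_nonneg (by linarith) k) ht.1
  have e := h ht0
  have hx1 : F (Set.Iic x) ≤ F {a | t ≤ f a} := by
    refine measure_mono fun a (ha : a ≤ x) => ?_
    have h2 : f x ≤ f a := hfa ha
    have h3 : f x = (1 - x) ^ k := by simp only [f]; rw [max_eq_left (by linarith)]
    exact (ht.2.le.trans h3.ge).trans h2
  have hy2 : B {a | t ≤ f a} ≤ ENNReal.ofReal (y ^ n) := by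
    rw [← maxUniformLaw_Iic n ⟨h0.trans hxy.le, hy1.le⟩]
    refine measure_mono fun a (ha : t ≤ f a) => ?_
    by_contra hya
    have h2 : f a ≤ f y := hfa (not_le.1 hya).le
    have h3 : f y = (1 - y) ^ k := by simp only [f]; rw [max_eq_left (by linarith)]
    exact absurd (ha.trans (h2.trans h3.le)) (not_le.2 ht.1)
  rw [e] at hy2
  exact absurd (hx1.trans hy2) (not_le.2 hy)

namespace ScenarioProblem

variable {n m : ℕ} {Q : Type*} {S : ScenarioProblem n Q} {ω : Fin m → Q} {I J : Finset (Fin m)}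

theorem optValue_eq {θ : EuclideanSpace ℝ (Fin n)} (hθ : θ ∈ S.optimalSet ω I) :
    S.optValue ω I = S.cost θ := by
  refine IsLeast.csInf_eq ⟨⟨θ, hθ.1, rfl⟩, ?_⟩
  rintro _ ⟨θ', hθ', rfl⟩
  exact hθ.2 θ' hθ'

/-- The solution of the sample `b` satisfies the constraint `q`. -/
def Satisfies (S : ScenarioProblem n Q) (b : Fin n → Q) (q : Q) : Prop :=
  S.f (S.leastNormOptimum b Finset.univ) q ≤ 0

section

variable (hS : S.IsConvex)
include hS

theorem leastNormOptimum_eq_of_mem (hIJ : I ⊆ J) (hne : (S.feasible ω I).Nonempty)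
    (h : S.leastNormOptimum ω I ∈ S.feasible ω J) :
    S.leastNormOptimum ω I = S.leastNormOptimum ω J := by
  obtain ⟨h1, h2⟩ := leastNormOptimum_spec hS hne
  obtain ⟨h3, -⟩ := leastNormOptimum_spec hS ⟨_, h⟩
  refine eq_leastNormOptimum hS ⟨h, fun θ hθ => h1.2 θ (feasible_anti hIJ hθ)⟩ (h2 _ ?_)
  exact ⟨feasible_anti hIJ h3.1, fun θ hθ => (h3.2 _ h).trans (h1.2 θ hθ)⟩

/-- If j were outside I, removing constraint j would keep all of I, which already enforces the full
optimal value. -/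
theorem isSupport_mem (hne : (S.feasible ω Finset.univ).Nonempty)
    (h : S.leastNormOptimum ω I = S.leastNormOptimum ω Finset.univ) {j : Fin m}
    (hj : S.IsSupport ω j) : j ∈ I := by
  by_contra hjI
  have hne' := fun I => feasible_nonempty_of_univ (I := I) hne
  obtain ⟨h1, -⟩ := leastNormOptimum_spec hS (hne' I)
  obtain ⟨h2, -⟩ := leastNormOptimum_spec hS (hne' (Finset.univ.erase j))
  obtain ⟨h3, -⟩ := leastNormOptimum_spec hS hne
  rw [IsSupport, optValue_eq h2, optValue_eq h3, ← h] at hj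
  refine absurd hj (not_lt.2 (h1.2 _ (feasible_anti (fun i hi => ?_) h2.1)))
  exact Finset.mem_erase.2 ⟨fun e => hjI (e ▸ hi), Finset.mem_univ i⟩

/-- The least-norm optimum minimises (cost, squared norm) lexicographically. The set D of
lexicographically better points is convex, so the Helly argument works without regularisation. -/
theorem exists_leastNormOptimum_basis (hne : (S.feasible ω Finset.univ).Nonempty) :
    ∃ B : Finset (Fin m), B.card ≤ n ∧
      S.leastNormOptimum ω B = S.leastNormOptimum ω Finset.univ := by
  obtain ⟨hopt, hmin⟩ := leastNormOptimum_spec hS hne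
  set θ₀ := S.leastNormOptimum ω Finset.univ
  let D : Set (EuclideanSpace ℝ (Fin n)) :=
    {θ | θ ∈ S.Θ ∧ (S.cost θ < S.cost θ₀ ∨ S.cost θ = S.cost θ₀ ∧ ‖θ‖ ^ 2 < ‖θ₀‖ ^ 2)}
  have hD : Convex ℝ D := by
    rw [convex_iff_forall_pos]
    rintro x ⟨hx, hx'⟩ y ⟨hy, hy'⟩ a b ha hb hab
    refine ⟨hS.convex hx hy ha.le hb.le hab, ?_⟩
    have hc : S.cost (a • x + b • y) = a * S.cost x + b * S.cost y := by
      simp [cost, inner_add_right, inner_smul_right]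
    have hsq : ‖a • x + b • y‖ ^ 2 ≤ a * ‖x‖ ^ 2 + b * ‖y‖ ^ 2 :=
      strictConvexOn_normSq.convexOn.2 (Set.mem_univ x) (Set.mem_univ y) ha.le hb.le hab
    have hv : S.cost θ₀ = a * S.cost θ₀ + b * S.cost θ₀ := by rw [← add_mul, hab, one_mul]
    have hr : ‖θ₀‖ ^ 2 = a * ‖θ₀‖ ^ 2 + b * ‖θ₀‖ ^ 2 := by rw [← add_mul, hab, one_mul]
    rcases hx' with h1 | ⟨h1, h1'⟩
    · left
      have h2 : S.cost y ≤ S.cost θ₀ := hy'.elim le_of_lt fun h => h.1.le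
      rw [hc, hv]
      exact add_lt_add_of_lt_of_le (mul_lt_mul_of_pos_left h1 ha)
        (mul_le_mul_of_nonneg_left h2 hb.le)
    · rcases hy' with h2 | ⟨h2, h2'⟩
      · left
        rw [hc, hv, h1]
        have := mul_lt_mul_of_pos_left h2 hb
        linarith
      · right
        refine ⟨by rw [hc, h1, h2, ← hv], hsq.trans_lt ?_⟩
        rw [hr]
        exact add_lt_add (mul_lt_mul_of_pos_left h1' ha) (mul_lt_mul_of_pos_left h2' hb)
  obtain ⟨B, -, hBc, hB⟩ := exists_card_le_finrank_disjoint hD (s := Finset.univ)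
    (K := fun i => {θ | S.f θ (ω i) ≤ 0}) (fun i _ => hS.convex_setOf _) (by
      rw [feasible_eq] at hne
      exact hne.mono Set.inter_subset_right) (by
      rintro θ ⟨h1, h2⟩
      by_contra hcon
      push Not at hcon
      have hθ : θ ∈ S.feasible ω Finset.univ := ⟨h1, fun i hi => hcon i hi⟩
      rcases h2 with h2 | ⟨h2, h3⟩
      · exact absurd (hopt.2 θ hθ) (not_le.2 h2)
      · exact absurd (hmin θ ⟨hθ, fun θ' hθ' => h2.le.trans (hopt.2 θ' hθ')⟩) (not_le.2 h3))
  refine ⟨B, by simpa using hBc, ?_⟩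
  obtain ⟨h1, -⟩ := leastNormOptimum_spec hS
    (hne.mono (feasible_anti (Finset.subset_univ B)))
  have hmemB := feasible_anti (Finset.subset_univ B) hopt.1
  have hnD : S.leastNormOptimum ω B ∉ D := fun h => by
    obtain ⟨i, hi, hi'⟩ := hB _ h
    exact hi' (h1.1.2 i hi)
  have hcost : S.cost (S.leastNormOptimum ω B) = S.cost θ₀ :=
    le_antisymm (h1.2 _ hmemB) (not_lt.1 fun hlt => hnD ⟨h1.1.1, Or.inl hlt⟩)
  have hnorm : ‖θ₀‖ ^ 2 ≤ ‖S.leastNormOptimum ω B‖ ^ 2 :=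
    not_lt.1 fun hlt => hnD ⟨h1.1.1, Or.inr ⟨hcost, hlt⟩⟩
  exact (eq_leastNormOptimum hS ⟨hmemB, fun θ hθ => hcost ▸ h1.2 θ hθ⟩ hnorm).symm

theorem leastNormOptimum_eq_of_isCompression (hne : (S.feasible ω Finset.univ).Nonempty)
    {s : Finset (Fin m)} {hcard : s.card = n} (h : IsCompression S.Satisfies s hcard ω) :
    S.leastNormOptimum ω s = S.leastNormOptimum ω Finset.univ := by
  have hne' := feasible_nonempty_of_univ (I := s) hne
  have hm := (leastNormOptimum_spec hS hne').1.1
  refine leastNormOptimum_eq_of_mem hS (Finset.subset_univ s) hne' ⟨hm.1, fun j _ => ?_⟩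
  by_cases hj : j ∈ s
  · exact hm.2 j hj
  · have := h j hj
    simpa only [Satisfies, leastNormOptimum, optimalSet, feasible_subTuple_univ] using this

omit hS in
theorem coe_eq_of_isSupport_mem (hfs : S.FullySupported ω) {s : Finset (Fin m)}
    (hcard : s.card ≤ n) (h : ∀ j, S.IsSupport ω j → j ∈ s) :
    (s : Set (Fin m)) = {j | S.IsSupport ω j} := by
  have hsub : {j | S.IsSupport ω j} ⊆ (s : Set (Fin m)) := h
  refine (Set.eq_of_subset_of_ncard_le hsub ?_ s.finite_toSet).symm
  rw [Set.ncard_coe_finset]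
  exact hcard.trans_eq (Eq.symm hfs)

/-- A basis has at most n elements and contains the n support constraints, hence consists of exactly
these. -/
theorem FullySupported.exists_isCompression (hfs : S.FullySupported ω)
    (hne : (S.feasible ω Finset.univ).Nonempty) :
    ∃ (s : Finset (Fin m)) (hcard : s.card = n), IsCompression S.Satisfies s hcard ω := by
  obtain ⟨B, hBc, hB⟩ := exists_leastNormOptimum_basis hS hne
  have h1 := coe_eq_of_isSupport_mem hfs hBc fun j hj => isSupport_mem hS hne hB hj
  have hcard : B.card = n := by
    rw [← Set.ncard_coe_finset, h1]; exact hfs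
  refine ⟨B, hcard, fun j _ => ?_⟩
  simp only [Satisfies, leastNormOptimum, optimalSet, feasible_subTuple_univ]
  rw [leastNormOptimum, optimalSet] at hB
  rw [hB]
  exact (leastNormOptimum_spec hS hne).1.1.2 j (Finset.mem_univ j)

theorem FullySupported.isCompression_unique (hfs : S.FullySupported ω)
    (hne : (S.feasible ω Finset.univ).Nonempty) {s s' : Finset (Fin m)}
    {hcard : s.card = n} {hcard' : s'.card = n} (h : IsCompression S.Satisfies s hcard ω)
    (h' : IsCompression S.Satisfies s' hcard' ω) : s = s' := by
  have h1 := coe_eq_of_isSupport_mem hfs hcard.le fun j hj =>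
    isSupport_mem hS hne (leastNormOptimum_eq_of_isCompression hS hne h) hj
  have h2 := coe_eq_of_isSupport_mem hfs hcard'.le fun j hj =>
    isSupport_mem hS hne (leastNormOptimum_eq_of_isCompression hS hne h') hj
  exact Finset.coe_injective (h1.trans h2.symm)

end

variable [MeasurableSpace Q] (P : Measure Q) [IsProbabilityMeasure P]
  (hS : S.IsConvex) (hf : ∀ θ, Measurable (S.f θ))
include hS hf

theorem measurableSet_satisfies :
    MeasurableSet {p : (Fin n → Q) × Q | S.Satisfies p.1 p.2} :=
  measurableSet_le ((measurable_uncurry_f hS hf).comp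
    (((measurable_leastNormOptimum hS hf Finset.univ).comp measurable_fst).prodMk measurable_snd))
    measurable_const

omit [IsProbabilityMeasure P] hS hf in
theorem rejection_satisfies (b : Fin n → Q) :
    rejection P S.Satisfies b = S.violation P (S.leastNormOptimum b Finset.univ) := by
  simp [rejection, violation, Satisfies]

variable (hne : ∀ m : ℕ, ∀ᵐ ω ∂(Measure.pi fun _ : Fin m => P),
  (S.feasible ω Finset.univ).Nonempty)
include hne

/-- Domination comes from the general bound at m = n, where the tail is x^n; the single moment comes
from unique compressions at size M. Strictness n < M makes the exponent M - n positive. -/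
theorem map_rejection_satisfies {M : ℕ} (hM : n < M) (hfs : S.FullySupportedAE P M) :
    (Measure.pi fun _ : Fin n => P).map (rejection P S.Satisfies) = maxUniformLaw n := by
  have hT := measurableSet_satisfies hS hf
  have hr := measurable_rejection P hT
  have := Measure.isProbabilityMeasure_map (μ := Measure.pi fun _ : Fin n => P) hr.aemeasurable
  refine eq_maxUniformLaw_of_le (k := M - n) (by omega) (map_rejection_compl P hT)
    (fun x hx => ?_) ?_
  · rw [Measure.map_apply hr measurableSet_Iic, ← binomTail_self n x]
    refine (binomTail_le_measure_leastNormOptimum P hS hf hne le_rfl hx).trans_eq ?_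
    congr 1
    ext b
    simp [rejection_satisfies]
  · have h1 := choose_mul_lintegral_map_rejection P hT (m := M)
      (by filter_upwards [hfs, hne M] with ω h1 h2 using h1.exists_isCompression hS h2)
      (by filter_upwards [hfs, hne M] with ω h1 h2 s s' _ _ h h' using
            h1.isCompression_unique hS h2 h h')
    have h2 := choose_mul_lintegral_maxUniformLaw hM.le
    have h0 : (M.choose n : ℝ≥0∞) ≠ 0 := by
      exact_mod_cast (Nat.choose_pos hM.le).ne'
    exact (ENNReal.mul_right_inj h0 (ENNReal.natCast_ne_top _)).1 (h1.trans h2.symm)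

/-- For fully supported problems, the law of the violation of the solution is known exactly. -/
theorem measure_leastNormOptimum_eq (hm : n ≤ m) (hfs : S.FullySupportedAE P m)
    (hfs' : m = n → S.FullySupportedAE P (n + 1)) {ε : ℝ} (hε : ε ∈ Set.Icc (0 : ℝ) 1) :
    (Measure.pi fun _ : Fin m => P) {ω | S.violation P (S.leastNormOptimum ω Finset.univ) ≤ ε}
      = ENNReal.ofReal (binomTail n m ε) := by
  have hmap : (Measure.pi fun _ : Fin n => P).map (rejection P S.Satisfies) = maxUniformLaw n := by
    rcases hm.eq_or_lt with h | h
    · exact map_rejection_satisfies P hS hf hne (Nat.lt_succ_self n) (hfs' h.symm)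
    · exact map_rejection_satisfies P hS hf hne h hfs
  have hT := measurableSet_satisfies hS hf
  rw [← measure_exists_isCompression_le P hT hmap hm (by
    filter_upwards [hfs, hne m] with ω h1 h2 s s' _ _ h h' using
      h1.isCompression_unique hS h2 h h') hε]
  refine measure_congr ?_
  filter_upwards [hfs, hne m] with ω h1 h2
  have key : ∀ (s : Finset (Fin m)) (hs : s.card = n), IsCompression S.Satisfies s hs ω →
      rejection P S.Satisfies (subTuple s hs ω)
        = S.violation P (S.leastNormOptimum ω Finset.univ) := by
    intro s hs h
    rw [rejection_satisfies, ← leastNormOptimum_eq_of_isCompression hS h2 h]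
    simp only [leastNormOptimum, optimalSet, feasible_subTuple_univ]
  refine propext ⟨fun h => ?_, ?_⟩
  · obtain ⟨s, hs, hcomp⟩ := h1.exists_isCompression hS h2
    exact ⟨s, hs, hcomp, (key s hs hcomp).trans_le h⟩
  · rintro ⟨s, hs, hcomp, hle⟩
    exact (key s hs hcomp).symm.trans_le hle

end ScenarioProblem

end

/-! ### The running time as a geometric variable. -/

noncomputable section

theorem ENat.toENNReal_eq_tsum (K : ℕ∞) :
    (K : ℝ≥0∞) = ∑' k : ℕ, Set.indicator {k : ℕ | (k : ℕ∞) < K} (fun _ => (1 : ℝ≥0∞)) k := by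
  induction K using ENat.recTopCoe with
  | top => simp
  | coe N =>
    rw [tsum_eq_sum (s := Finset.range N)]
    · rw [Finset.sum_congr rfl (g := fun _ => (1 : ℝ≥0∞))]
      · simp
      · intro k hk
        exact Set.indicator_of_mem (by simpa using hk) _
    · intro k hk
      exact Set.indicator_of_notMem (by simpa using hk) _

namespace ScenarioProblem

variable {n N : ℕ} {Q : Type*} [MeasurableSpace Q] {S : ScenarioProblem n Q} {P : Measure Q}
  {ε : ℝ} {sol : (Fin N → Q) → EuclideanSpace ℝ (Fin n)} {w : ℕ → Fin N → Q}

theorem rsdStep_iterate_running {k : ℕ}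
    (h : ∀ i, 1 ≤ i → i ≤ k → ¬ S.violation P (sol (w i)) ≤ ε) :
    (S.rsdStep P ε sol w)^[k] (.running 1) = .running (k + 1) := by
  induction k with
  | zero => rfl
  | succ k ih =>
    rw [Function.iterate_succ_apply', ih fun i h1 h2 => h i h1 (by omega), rsdStep,
      if_neg (h (k + 1) (by omega) le_rfl)]

theorem rsdExits_iff {k : ℕ} {θ : EuclideanSpace ℝ (Fin n)} :
    S.RSDExits P ε sol w k θ ↔ 1 ≤ k ∧ θ = sol (w k) ∧ S.violation P (sol (w k)) ≤ ε ∧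
      ∀ i, 1 ≤ i → i < k → ¬ S.violation P (sol (w i)) ≤ ε := by
  constructor
  · rintro ⟨t, ht⟩
    -- After t steps either iterations 1, …, t have all failed, or the state is frozen at the first
    -- success.
    have inv : ∀ t : ℕ, (∀ i, 1 ≤ i → i ≤ t → ¬ S.violation P (sol (w i)) ≤ ε) ∨
        ∃ j, (S.rsdStep P ε sol w)^[t] (.running 1) = .exited j (sol (w j)) ∧ 1 ≤ j ∧
          S.violation P (sol (w j)) ≤ ε ∧
          ∀ i, 1 ≤ i → i < j → ¬ S.violation P (sol (w i)) ≤ ε := by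
      intro t
      induction t with
      | zero => left; intro i h1 h2; omega
      | succ t ih =>
        rcases ih with h | ⟨j, hj, h⟩
        · by_cases hv : S.violation P (sol (w (t + 1))) ≤ ε
          · right
            refine ⟨t + 1, ?_, by omega, hv, fun i h1 h2 => h i h1 (by omega)⟩
            rw [Function.iterate_succ_apply', rsdStep_iterate_running h, rsdStep, if_pos hv]
          · left
            intro i h1 h2
            rcases Nat.lt_or_ge i (t + 1) with h3 | h3
            · exact h i h1 (by omega)
            · rwa [show i = t + 1 by omega]
        · right
          exact ⟨j, by rw [Function.iterate_succ_apply', hj, rsdStep], h⟩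
    rcases inv t with h | ⟨j, hj, h⟩
    · rw [rsdStep_iterate_running h] at ht
      exact absurd ht (by simp)
    · rw [hj] at ht
      obtain ⟨rfl, rfl⟩ := RSDState.exited.inj ht
      exact ⟨h.1, rfl, h.2⟩
  · rintro ⟨hk, rfl, hv, h⟩
    obtain ⟨k, rfl⟩ : ∃ k', k = k' + 1 := ⟨k - 1, by omega⟩
    refine ⟨k + 1, ?_⟩
    rw [Function.iterate_succ_apply', rsdStep_iterate_running fun i h1 h2 => h i h1 (by omega),
      rsdStep, if_pos hv]

theorem lt_rsdTime_iff {k : ℕ} : (k : ℕ∞) < S.rsdTime P ε sol w ↔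
    ∀ i ∈ Finset.Icc 1 k, ¬ S.violation P (sol (w i)) ≤ ε := by
  classical
  constructor
  · intro hlt i hi hv
    have hex : ∃ i, 1 ≤ i ∧ S.violation P (sol (w i)) ≤ ε := ⟨i, (Finset.mem_Icc.1 hi).1, hv⟩
    have hle : S.rsdTime P ε sol w ≤ (Nat.find hex : ℕ∞) :=
      iInf₂_le (Nat.find hex) ⟨_, rsdExits_iff.2 ⟨(Nat.find_spec hex).1, rfl,
        (Nat.find_spec hex).2, fun j h1 h2 h3 => Nat.find_min hex h2 ⟨h1, h3⟩⟩⟩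
    have h1 : Nat.find hex ≤ i := Nat.find_min' hex ⟨(Finset.mem_Icc.1 hi).1, hv⟩
    have h2 : k < Nat.find hex := by exact_mod_cast hlt.trans_le hle
    have := (Finset.mem_Icc.1 hi).2
    omega
  · intro h
    have : ((k + 1 : ℕ) : ℕ∞) ≤ S.rsdTime P ε sol w := by
      refine le_iInf₂ fun j hj => ?_
      obtain ⟨θ, hθ⟩ := hj
      obtain ⟨h1, -, h2, -⟩ := rsdExits_iff.1 hθ
      have : k + 1 ≤ j := by
        by_contra hlt
        exact h j (Finset.mem_Icc.2 ⟨h1, by omega⟩) h2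
      exact_mod_cast this
    exact lt_of_lt_of_le (by exact_mod_cast Nat.lt_succ_self k) this

section Law

variable [IsProbabilityMeasure P] {A : Set (Fin N → Q)}

instance : IsProbabilityMeasure (rsdLaw P N) := by
  unfold rsdLaw
  infer_instance

theorem rsdLaw_forall_notMem (hA : MeasurableSet A) (k : ℕ) :
    rsdLaw P N {w | ∀ i ∈ Finset.Icc 1 k, w i ∉ A}
      = (1 - (Measure.pi fun _ : Fin N => P) A) ^ k := by
  have : {w : ℕ → Fin N → Q | ∀ i ∈ Finset.Icc 1 k, w i ∉ A}
      = Set.pi (Finset.Icc 1 k : Finset ℕ) fun _ => Aᶜ := by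
    ext w; simp [Set.pi]
  rw [this, rsdLaw, Measure.infinitePi_pi _ fun _ _ => hA.compl, Finset.prod_const,
    prob_compl_eq_one_sub hA]
  simp

theorem measurableSet_forall_notMem (hA : MeasurableSet A) (k : ℕ) :
    MeasurableSet {w : ℕ → Fin N → Q | ∀ i ∈ Finset.Icc 1 k, w i ∉ A} := by
  have : {w : ℕ → Fin N → Q | ∀ i ∈ Finset.Icc 1 k, w i ∉ A} =
      ⋂ i ∈ Finset.Icc 1 k, {w | w i ∈ A}ᶜ := by
    ext w; simp
  rw [this]
  exact MeasurableSet.biInter (Set.to_countable _) fun i _ =>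
    (hA.preimage (measurable_pi_apply i)).compl

variable (hA : MeasurableSet A)
  (hsol : ∀ᵐ v ∂(Measure.pi fun _ : Fin N => P), S.violation P (sol v) ≤ ε ↔ v ∈ A)
include hsol

/-- The solver need not be measurable, so its success event is replaced by a set A with which it
agrees almost surely, simultaneously in all iterations. -/
theorem ae_lt_rsdTime_iff : ∀ᵐ w ∂(rsdLaw P N), ∀ k : ℕ,
    (k : ℕ∞) < S.rsdTime P ε sol w ↔ ∀ i ∈ Finset.Icc 1 k, w i ∉ A := by
  have h : ∀ᵐ w ∂(rsdLaw P N), ∀ i, S.violation P (sol (w i)) ≤ ε ↔ w i ∈ A := by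
    refine ae_all_iff.2 fun i => ?_
    exact (measurePreserving_eval_infinitePi (fun _ : ℕ => Measure.pi fun _ : Fin N => P)
      i).quasiMeasurePreserving.ae hsol
  filter_upwards [h] with w hw k
  rw [lt_rsdTime_iff]
  exact forall₂_congr fun i _ => not_congr (hw i)

theorem rsdTime_ae_eq : (fun w => (S.rsdTime P ε sol w : ℝ≥0∞)) =ᵐ[rsdLaw P N] fun w =>
    ∑' k : ℕ, Set.indicator {w | ∀ i ∈ Finset.Icc 1 k, w i ∉ A} (fun _ => (1 : ℝ≥0∞)) w := by
  filter_upwards [ae_lt_rsdTime_iff hsol] with w hw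
  rw [ENat.toENNReal_eq_tsum]
  refine tsum_congr fun k => ?_
  by_cases hk : (k : ℕ∞) < S.rsdTime P ε sol w
  · rw [Set.indicator_of_mem (show k ∈ {k : ℕ | (k : ℕ∞) < S.rsdTime P ε sol w} from hk),
      Set.indicator_of_mem (show w ∈ {w | ∀ i ∈ Finset.Icc 1 k, w i ∉ A} from (hw k).1 hk)]
  · rw [Set.indicator_of_notMem (show k ∉ {k : ℕ | (k : ℕ∞) < S.rsdTime P ε sol w} from hk),
      Set.indicator_of_notMem (show w ∉ {w | ∀ i ∈ Finset.Icc 1 k, w i ∉ A} from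
        fun h => hk ((hw k).2 h))]

include hA

theorem aemeasurable_rsdTime :
    AEMeasurable (fun w => (S.rsdTime P ε sol w : ℝ≥0∞)) (rsdLaw P N) :=
  ⟨_, Measurable.tsum fun k =>
    measurable_const.indicator (measurableSet_forall_notMem hA k), rsdTime_ae_eq hsol⟩

/-- Sum P(K > k) = (1 - p)^k over k ≥ 0, where p is the probability of A; for p = 0 both sides are
infinite. -/
theorem lintegral_rsdTime : ∫⁻ w, (S.rsdTime P ε sol w : ℝ≥0∞) ∂(rsdLaw P N)
    = ((Measure.pi fun _ : Fin N => P) A)⁻¹ := by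
  rw [lintegral_congr_ae (rsdTime_ae_eq hsol), lintegral_tsum fun k =>
    (measurable_const.indicator (measurableSet_forall_notMem hA k)).aemeasurable]
  simp only [lintegral_indicator_const (measurableSet_forall_notMem hA _), one_mul,
    rsdLaw_forall_notMem hA]
  rw [ENNReal.tsum_geometric, ENNReal.sub_sub_cancel ENNReal.one_ne_top prob_le_one]

theorem measureReal_rsdTime_le (k : ℕ) :
    (rsdLaw P N).real {w | S.rsdTime P ε sol w ≤ (k : ℕ∞)}
      = 1 - (1 - (Measure.pi fun _ : Fin N => P).real A) ^ k := by
  have h : (rsdLaw P N).real {w | S.rsdTime P ε sol w ≤ (k : ℕ∞)} =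
      (rsdLaw P N).real {w | ∀ i ∈ Finset.Icc 1 k, w i ∉ A}ᶜ := by
    refine measureReal_congr ?_
    filter_upwards [ae_lt_rsdTime_iff hsol] with w hw
    refine propext ?_
    change S.rsdTime P ε sol w ≤ (k : ℕ∞) ↔ ¬ ∀ i ∈ Finset.Icc 1 k, w i ∉ A
    rw [← hw k, not_lt]
  rw [h, probReal_compl_eq_one_sub (measurableSet_forall_notMem hA k), measureReal_def,
    rsdLaw_forall_notMem hA, ENNReal.toReal_pow, ENNReal.toReal_sub_of_le prob_le_one
    ENNReal.one_ne_top, ENNReal.toReal_one, measureReal_def]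

end Law

theorem UniquelySolvable.ae_feasible [IsProbabilityMeasure P] {m : ℕ}
    (h : S.UniquelySolvable P m) :
    ∀ᵐ ω ∂(Measure.pi fun _ : Fin m => P), (S.feasible ω Finset.univ).Nonempty := by
  filter_upwards [h] with ω hω
  exact hω.exists.imp fun _ h => h.1

end ScenarioProblem

theorem one_sub_scenarioBeta (n N : ℕ) (ε : ℝ) : 1 - scenarioBeta n N ε = binomTail n N ε :=
  sub_sub_cancel _ _

end

theorem theorem2 {n : ℕ} {Q : Type*} [MeasurableSpace Q]
    (P : Measure Q) [IsProbabilityMeasure P] (S : ScenarioProblem n Q)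
    (hΘconv : Convex ℝ S.Θ) (hΘcomp : IsCompact S.Θ)
    (hfconv : ∀ q, ConvexOn ℝ Set.univ (fun θ => S.f θ q))
    (hfmeas : ∀ θ, Measurable (S.f θ))
    (N : ℕ) (hN : n ≤ N) (ε : ℝ) (hε : ε ∈ Set.Icc (0 : ℝ) 1)
    (hA : S.UniquelySolvable P N)
    (hA' : N = n → S.UniquelySolvable P (n + 1))
    (sol : (Fin N → Q) → EuclideanSpace ℝ (Fin n)) (hsol : S.IsSolver sol) :
    -- every returned solution is an `ε`-probabilistic robust design
    (∀ w k θ, S.RSDExits P ε sol w k θ → S.violation P θ ≤ ε) ∧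
    -- the running time is a random variable
    AEMeasurable (fun w => (S.rsdTime P ε sol w : ℝ≥0∞)) (rsdLaw P N) ∧
    -- bound on the expected running time
    (∫⁻ w, (S.rsdTime P ε sol w : ℝ≥0∞) ∂(rsdLaw P N)
      ≤ (ENNReal.ofReal (1 - scenarioBeta n N ε))⁻¹) ∧
    -- bound on the distribution of the running time
    (∀ k : ℕ, 1 - scenarioBeta n N ε ^ k
      ≤ (rsdLaw P N).real {w | S.rsdTime P ε sol w ≤ (k : ℕ∞)}) ∧
    -- both bounds are equalities for fully supported problems
    (S.FullySupportedAE P N → (N = n → S.FullySupportedAE P (n + 1)) →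
      (∫⁻ w, (S.rsdTime P ε sol w : ℝ≥0∞) ∂(rsdLaw P N)
        = (ENNReal.ofReal (1 - scenarioBeta n N ε))⁻¹) ∧
      (∀ k : ℕ, (rsdLaw P N).real {w | S.rsdTime P ε sol w ≤ (k : ℕ∞)}
        = 1 - scenarioBeta n N ε ^ k)) := by
  have hS : S.IsConvex := ⟨hΘconv, hΘcomp, hfconv⟩
  have hne : ∀ m : ℕ, ∀ᵐ ω ∂(Measure.pi fun _ : Fin m => P),
      (S.feasible ω Finset.univ).Nonempty := by
    -- Helly needs almost sure feasibility for at least n + 1 scenarios: N itself provides it unless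
    -- N = n, where the extra assumption steps in.
    rcases hN.eq_or_lt with h | h
    · exact ScenarioProblem.ae_feasible_nonempty P hS hfmeas le_rfl (hA' h.symm).ae_feasible
    · exact ScenarioProblem.ae_feasible_nonempty P hS hfmeas h hA.ae_feasible
  -- The least-norm optimum is a measurable choice, and by unique solvability it almost surely
  -- equals what the solver returns.
  let A : Set (Fin N → Q) := {v | S.violation P (S.leastNormOptimum v Finset.univ) ≤ ε}
  have hAm : MeasurableSet A := measurableSet_le ((ScenarioProblem.measurable_violation P hS hfmeas).comp
    (ScenarioProblem.measurable_leastNormOptimum hS hfmeas Finset.univ)) measurable_const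
  have hsolA : ∀ᵐ v ∂(Measure.pi fun _ : Fin N => P), S.violation P (sol v) ≤ ε ↔ v ∈ A := by
    filter_upwards [hA] with v hv
    have h1 := hsol v hv.exists
    have h2 : S.IsOptimal v (S.leastNormOptimum v Finset.univ) :=
      (ScenarioProblem.leastNormOptimum_spec hS ⟨_, h1.1⟩).1
    rw [hv.unique h1 h2]
    rfl
  have hb := ScenarioProblem.binomTail_le_measure_leastNormOptimum P hS hfmeas hne hN hε
  have hb0 := binomTail_nonneg n N hε
  have hbeta : scenarioBeta n N ε = 1 - binomTail n N ε := rfl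
  refine ⟨fun w k θ h => ?_, ScenarioProblem.aemeasurable_rsdTime hAm hsolA, ?_, fun k => ?_, fun hfs hfs' => ?_⟩
  · obtain ⟨-, rfl, h, -⟩ := ScenarioProblem.rsdExits_iff.1 h
    exact h
  · rw [ScenarioProblem.lintegral_rsdTime hAm hsolA, one_sub_scenarioBeta]
    exact ENNReal.inv_le_inv.2 hb
  · rw [ScenarioProblem.measureReal_rsdTime_le hAm hsolA, hbeta]
    have h1 : binomTail n N ε ≤ (Measure.pi fun _ : Fin N => P).real A :=
      (ENNReal.ofReal_le_iff_le_toReal (measure_ne_top _ _)).1 hb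
    have h2 : (Measure.pi fun _ : Fin N => P).real A ≤ 1 := measureReal_le_one
    exact sub_le_sub_left (pow_le_pow_left₀ (by linarith) (by linarith) k) 1
  · have heq := ScenarioProblem.measure_leastNormOptimum_eq P hS hfmeas hne hN hfs hfs' hε
    refine ⟨?_, fun k => ?_⟩
    · rw [ScenarioProblem.lintegral_rsdTime hAm hsolA, one_sub_scenarioBeta]
      exact congrArg _ heq
    · have h1 : (Measure.pi fun _ : Fin N => P).real A = binomTail n N ε := by
        rw [measureReal_def, show (Measure.pi fun _ : Fin N => P) A = _ from heq,
          ENNReal.toReal_ofReal hb0]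
      rw [ScenarioProblem.measureReal_rsdTime_le hAm hsolA, hbeta, h1]
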